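/- In the tall/small scheduling problem we are given $n=n_1+n_2$ unit-length jobs, $m\ge 1$ parallel machines, and for every job $j\in\{1,\dots,n\}$ an integer release time $r_j$ and an integer deadline $D_j$. The first $n_1$ jobs are small and the remaining $n_2$ jobs are tall. A feasible schedule assigns to every job $j$ a time slot $[t_j,t_j+1)$ with $t_j\in\mathbb Z$, $r_j\le t_j$ and $t_j+1\le D_j$, and to every small job one of the $m$ machines, such that distinct tall jobs have distinct time slots, no small job has the same time slot as a tall job (tall jobs occupy all $m$ machines), and distinct small jobs have distinct (machine, time slot) pairs. The problem is to find a feasible schedule or to report that none exists. Claim: the tall/small scheduling problem can be solved in worst-case time $O(n^3)$. That is, there are one program for a random access machine (integer variables and arrays; constants, memory accesses, additions, subtractions, comparisons and Boolean operations at unit cost; no multiplication or division) and one constant $C$ such that on every instance $(n_1,n_2,m,(r_j),(D_j))$ the program halts after at most $C\,(n^3+1)$ time units, and either outputs a feasible schedule, or correctly reports that no feasible schedule exists. The constant $C$ does not depend on $n_1,n_2,m$, the release times or the deadlines. -/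

import Mathlib

namespace TallSmall

/-! ## The tall/small scheduling problem -/

/-- An instance: `numSmall + numTall` unit-length jobs, of which the first `numSmall` are small and
the remaining `numTall` are tall, `machines ≥ 1` parallel machines, and for every job an integer
release time and an integer deadline. -/
structure Problem where
  numSmall : ℕ
  numTall : ℕ
  machines : ℕ
  machines_pos : 0 < machines
  release : Fin (numSmall + numTall) → ℤ
  deadline : Fin (numSmall + numTall) → ℤ

/-- The total number `n` of jobs. -/
abbrev Problem.numJobs (I : Problem) : ℕ := I.numSmall + I.numTall

/-- The `i`-th small job, as a job. -/
def Problem.small (I : Problem) (i : Fin I.numSmall) : Fin I.numJobs := Fin.castAdd I.numTall i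

/-- The `i`-th tall job, as a job. -/
def Problem.tall (I : Problem) (i : Fin I.numTall) : Fin I.numJobs := Fin.natAdd I.numSmall i

/-- A (not necessarily feasible) schedule: every job gets a time slot `[t, t + 1)`, represented by
its left end `t : ℤ`, and every small job gets a machine. (Tall jobs run on all machines.) -/
structure Schedule (I : Problem) where
  slot : Fin I.numJobs → ℤ
  machine : Fin I.numSmall → Fin I.machines

/-- Feasibility of a schedule. -/
structure Schedule.Feasible {I : Problem} (σ : Schedule I) : Prop where
  /-- the slot `[t, t + 1)` of each job lies between its release time and its deadline -/
  window : ∀ j, I.release j ≤ σ.slot j ∧ σ.slot j + 1 ≤ I.deadline j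
  /-- different tall jobs run in different time slots -/
  tall_tall : ∀ i j, i ≠ j → σ.slot (I.tall i) ≠ σ.slot (I.tall j)
  /-- a small job never runs in the time slot of a tall job -/
  small_tall : ∀ i j, σ.slot (I.small i) ≠ σ.slot (I.tall j)
  /-- different small jobs get different pairs of a time slot and a machine -/
  small_small : ∀ i j, i ≠ j →
    (σ.slot (I.small i), σ.machine i) ≠ (σ.slot (I.small j), σ.machine j)

/-! ## A random access machine with a step count

Programs manipulate finitely many integer variables and finitely many integer arrays. The only
arithmetic operations are addition and subtraction; every constant, variable access, array access,
arithmetic operation, comparison and Boolean operation costs one time unit. -/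

/-- A memory state: the values of the variables and of the array cells. -/
structure State where
  var : ℕ → ℤ
  arr : ℕ → ℤ → ℤ

/-- Write a variable. -/
def State.setVar (s : State) (x : ℕ) (v : ℤ) : State :=
  { s with var := Function.update s.var x v }

/-- Write the cell with index `i` of the array with name `a`. -/
def State.setArr (s : State) (a : ℕ) (i v : ℤ) : State :=
  { s with arr := Function.update s.arr a (Function.update (s.arr a) i v) }

/-- Integer expressions; `read a e` is the cell of the array `a` whose index is the value of `e`. -/
inductive Expr where
  | const (c : ℤ)
  | var (x : ℕ)
  | read (a : ℕ) (e : Expr)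
  | add (e f : Expr)
  | sub (e f : Expr)

/-- The value of an expression. -/
def Expr.eval (s : State) : Expr → ℤ
  | .const c => c
  | .var x => s.var x
  | .read a e => s.arr a (e.eval s)
  | .add e f => e.eval s + f.eval s
  | .sub e f => e.eval s - f.eval s

/-- The time to evaluate an expression. -/
def Expr.cost : Expr → ℕ
  | .const _ => 1
  | .var _ => 1
  | .read _ e => e.cost + 1
  | .add e f => e.cost + f.cost + 1
  | .sub e f => e.cost + f.cost + 1

/-- Boolean tests. -/
inductive Test where
  | le (e f : Expr)
  | eq (e f : Expr)
  | neg (b : Test)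
  | conj (b c : Test)

/-- The truth value of a test. -/
def Test.Holds (s : State) : Test → Prop
  | .le e f => e.eval s ≤ f.eval s
  | .eq e f => e.eval s = f.eval s
  | .neg b => ¬ b.Holds s
  | .conj b c => b.Holds s ∧ c.Holds s

/-- The time to evaluate a test. -/
def Test.cost : Test → ℕ
  | .le e f => e.cost + f.cost + 1
  | .eq e f => e.cost + f.cost + 1
  | .neg b => b.cost + 1
  | .conj b c => b.cost + c.cost + 1

/-- Programs: `assign x e` is `x := e`, `store a i e` is `a[i] := e`, `branch b p q` is
`if b then p else q`, and `loop b p` is `while b do p`. -/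
inductive Program where
  | skip
  | assign (x : ℕ) (e : Expr)
  | store (a : ℕ) (i e : Expr)
  | seq (p q : Program)
  | branch (b : Test) (p q : Program)
  | loop (b : Test) (p : Program)

/-- `Exec p s s' t`: started in the state `s`, the program `p` halts in the state `s'` after exactly
`t` time units. -/
inductive Exec : Program → State → State → ℕ → Prop where
  | skip (s : State) : Exec .skip s s 1
  | assign (s : State) (x : ℕ) (e : Expr) :
      Exec (.assign x e) s (s.setVar x (e.eval s)) (e.cost + 1)
  | store (s : State) (a : ℕ) (i e : Expr) :
      Exec (.store a i e) s (s.setArr a (i.eval s) (e.eval s)) (i.cost + e.cost + 1)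
  | seq {p q : Program} {s s' s'' : State} {t t' : ℕ} :
      Exec p s s' t → Exec q s' s'' t' → Exec (.seq p q) s s'' (t + t')
  | branch_true {b : Test} {p q : Program} {s s' : State} {t : ℕ} :
      b.Holds s → Exec p s s' t → Exec (.branch b p q) s s' (b.cost + t)
  | branch_false {b : Test} {p q : Program} {s s' : State} {t : ℕ} :
      ¬ b.Holds s → Exec q s s' t → Exec (.branch b p q) s s' (b.cost + t)
  | loop_true {b : Test} {p : Program} {s s' s'' : State} {t t' : ℕ} :
      b.Holds s → Exec p s s' t → Exec (.loop b p) s' s'' t' →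
      Exec (.loop b p) s s'' (b.cost + t + t')
  | loop_false {b : Test} {p : Program} {s : State} :
      ¬ b.Holds s → Exec (.loop b p) s s b.cost

/-- The machine is deterministic: the final state and the running time are functions of the program
and of the initial state. -/
theorem Exec.deterministic {p : Program} {s s₁ s₂ : State} {t₁ t₂ : ℕ}
    (h₁ : Exec p s s₁ t₁) (h₂ : Exec p s s₂ t₂) : s₁ = s₂ ∧ t₁ = t₂ := by
  induction h₁ generalizing s₂ t₂ with
  | skip s => cases h₂; exact ⟨rfl, rfl⟩
  | assign s x e => cases h₂; exact ⟨rfl, rfl⟩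
  | store s a i e => cases h₂; exact ⟨rfl, rfl⟩
  | seq _ _ ih ih' =>
    cases h₂ with
    | seq k k' =>
      obtain ⟨rfl, rfl⟩ := ih k
      obtain ⟨rfl, rfl⟩ := ih' k'
      exact ⟨rfl, rfl⟩
  | branch_true hb _ ih =>
    cases h₂ with
    | branch_true _ k =>
      obtain ⟨rfl, rfl⟩ := ih k
      exact ⟨rfl, rfl⟩
    | branch_false hb' _ => exact absurd hb hb'
  | branch_false hb _ ih =>
    cases h₂ with
    | branch_true hb' _ => exact absurd hb' hb
    | branch_false _ k =>
      obtain ⟨rfl, rfl⟩ := ih k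
      exact ⟨rfl, rfl⟩
  | loop_true hb _ _ ih ih' =>
    cases h₂ with
    | loop_true _ k k' =>
      obtain ⟨rfl, rfl⟩ := ih k
      obtain ⟨rfl, rfl⟩ := ih' k'
      exact ⟨rfl, rfl⟩
    | loop_false hb' => exact absurd hb hb'
  | loop_false hb =>
    cases h₂ with
    | loop_true hb' _ _ => exact absurd hb' hb
    | loop_false _ => exact ⟨rfl, rfl⟩

/-! ## Input, output, and solving the problem on the machine -/

/-- The input convention: variables `0`, `1`, `2` hold the numbers of small jobs, of tall jobs and
of machines, the cells `0, …, n - 1` of the arrays `0` and `1` hold the release times and the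
deadlines, and everything else is `0`. -/
def Problem.input (I : Problem) : State where
  var x :=
    if x = 0 then (I.numSmall : ℤ)
    else if x = 1 then (I.numTall : ℤ)
    else if x = 2 then (I.machines : ℤ)
    else 0
  arr a i :=
    if h : 0 ≤ i ∧ i.toNat < I.numJobs then
      if a = 0 then I.release ⟨i.toNat, h.2⟩
      else if a = 1 then I.deadline ⟨i.toNat, h.2⟩
      else 0
    else 0

/-- The output convention for schedules: cell `j` of array `2` holds the time slot of job `j`, and
for small jobs `j`, cell `j` of array `3` holds its machine (machines are numbered from `0`). -/
def State.Encodes {I : Problem} (s : State) (σ : Schedule I) : Prop :=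
  (∀ j : Fin I.numJobs, s.arr 2 (j : ℕ) = σ.slot j) ∧
  (∀ i : Fin I.numSmall, s.arr 3 (i : ℕ) = ((σ.machine i : ℕ) : ℤ))

/-- The final state `s` is a correct answer to the instance `I`: either variable `3` holds `1` and
a feasible schedule has been written, or variable `3` holds `0` and no feasible schedule exists. -/
def Problem.IsCorrectAnswer (I : Problem) (s : State) : Prop :=
  (s.var 3 = 1 ∧ ∃ σ : Schedule I, σ.Feasible ∧ s.Encodes σ) ∨
  (s.var 3 = 0 ∧ ¬ ∃ σ : Schedule I, σ.Feasible)

/-- `p` solves the tall/small scheduling problem within time `T`: on every instance `I`, the program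
halts after at most `T I` time units with a correct answer. -/
def Program.SolvesWithin (p : Program) (T : Problem → ℕ) : Prop :=
  ∀ I : Problem, ∃ (s : State) (t : ℕ), Exec p I.input s t ∧ t ≤ T I ∧ I.IsCorrectAnswer s

end TallSmall

namespace TallSmall

/-! ## Programs with counting loops only -/

/-! Only the 2n release times and deadlines `tau i` matter. Let `y i` be the number of tall slots
before `tau i`. Between two such times a feasible schedule has at least as many tall slots as tall
jobs whose windows lie there, and the other slots, times m, are at least as many as the small jobs
whose windows lie there. These are difference constraints on 2n integers (`Jobs.Pot`), necessary by
`Jobs.Good.pot`.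

They are also sufficient for instances with nonempty windows. For a solution `y`, both `y` and `tau
- y` are monotone in `tau` (`Pot.mono`), so the slots can be split by putting, in each gap between
consecutive times, the tall slots last and the others first. Number the slots of each kind in
increasing order. A job with release time r and deadline d then has an interval of admissible
positions: from y(r) to y(d) if tall, from r - y(r) to d - y(d) if small. The constraints become
Hall's condition for these intervals with capacities 1 and m (`Pot.hall`). Taking jobs by earliest
end and putting each at the first position that is not full then succeeds (`IsGreedy.lt_hi`), and
explicit minimum and maximum formulas turn positions back into slots (`Pot.good`).

All stages are at most cubic. The weights take n steps for each of the 4n² pairs, with division by m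
replaced by counting in bundles. A solution `y` is a row of longest path lengths in a complete
digraph on 2n nodes, found by Floyd-Warshall. The greedy stage has n jobs, n candidate positions for
each, and n steps to count the load of a position.

Infeasibility need not be detected along the way. Every loop is a counting loop with bound n or 2n
and nesting is at most three deep, so the program halts in cubic time even when the intermediate
tables are meaningless. The resulting schedule is then verified: if some feasible schedule exists,
the computed one passes; if the check fails, none exists. -/

/-- Programs all of whose loops are counting loops: `count x b p` runs `p` for
`x = 0, …, b - 1`, where `b` is a variable. -/
inductive Code where
  | skip
  | assign (x : ℕ) (e : Expr)
  | store (a : ℕ) (i e : Expr)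
  | seq (p q : Code)
  | branch (b : Test) (p q : Code)
  | count (x b : ℕ) (p : Code)

/-- The states at the beginning of the rounds of a counting loop with counter `x` and body `f`. -/
def loopState (f : State → State) (x : ℕ) (s : State) : ℕ → State
  | 0 => s.setVar x 0
  | k + 1 => (f (loopState f x s k)).setVar x (k + 1)

namespace Code

open Classical in
/-- The effect of a program with counting loops on the state. -/
noncomputable def run : Code → State → State
  | skip => fun s => s
  | assign x e => fun s => s.setVar x (e.eval s)
  | store a i e => fun s => s.setArr a (i.eval s) (e.eval s)
  | seq p q => fun s => q.run (p.run s)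
  | branch b p q => fun s => if b.Holds s then p.run s else q.run s
  | count x b p => fun s => loopState p.run x s (s.var b).toNat

theorem run_skip (s : State) : skip.run s = s := rfl

theorem run_assign (x : ℕ) (e : Expr) (s : State) :
    (assign x e).run s = s.setVar x (e.eval s) := rfl

theorem run_store (a : ℕ) (i e : Expr) (s : State) :
    (store a i e).run s = s.setArr a (i.eval s) (e.eval s) := rfl

theorem run_seq (p q : Code) (s : State) : (seq p q).run s = q.run (p.run s) := rfl

open Classical in
theorem run_branch (b : Test) (p q : Code) (s : State) :
    (branch b p q).run s = if b.Holds s then p.run s else q.run s := rfl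

/-- The translation to programs of the machine. -/
def toProgram : Code → Program
  | skip => .skip
  | assign x e => .assign x e
  | store a i e => .store a i e
  | seq p q => .seq p.toProgram q.toProgram
  | branch b p q => .branch b p.toProgram q.toProgram
  | count x b p => .seq (.assign x (.const 0)) (.loop (.neg (.le (.var b) (.var x)))
      (.seq p.toProgram (.assign x (.add (.var x) (.const 1)))))

/-- The variables that a program may write. -/
def writes : Code → List ℕ
  | skip => []
  | assign x _ => [x]
  | store _ _ _ => []
  | seq p q => p.writes ++ q.writes
  | branch _ p q => p.writes ++ q.writes
  | count x _ p => x :: p.writes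

/-- The arrays that a program may write. -/
def stores : Code → List ℕ
  | skip => []
  | assign _ _ => []
  | store a _ _ => [a]
  | seq p q => p.stores ++ q.stores
  | branch _ p q => p.stores ++ q.stores
  | count _ _ p => p.stores

/-- All loop bounds belong to `B`, no variable of `B` is written, and no counter is written by the
body of its loop. -/
def WellFormed (B : List ℕ) : Code → Prop
  | skip => True
  | assign x _ => x ∉ B
  | store _ _ _ => True
  | seq p q => p.WellFormed B ∧ q.WellFormed B
  | branch _ p q => p.WellFormed B ∧ q.WellFormed B
  | count x b p => b ∈ B ∧ x ∉ B ∧ x ∉ p.writes ∧ p.WellFormed B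

instance decidableWellFormed (B : List ℕ) : (p : Code) → Decidable (p.WellFormed B)
  | skip => inferInstanceAs (Decidable True)
  | assign x _ => inferInstanceAs (Decidable (x ∉ B))
  | store _ _ _ => inferInstanceAs (Decidable True)
  | seq p q =>
    haveI := decidableWellFormed B p
    haveI := decidableWellFormed B q
    inferInstanceAs (Decidable (p.WellFormed B ∧ q.WellFormed B))
  | branch _ p q =>
    haveI := decidableWellFormed B p
    haveI := decidableWellFormed B q
    inferInstanceAs (Decidable (p.WellFormed B ∧ q.WellFormed B))
  | count x b p =>
    haveI := decidableWellFormed B p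
    inferInstanceAs (Decidable (b ∈ B ∧ x ∉ B ∧ x ∉ p.writes ∧ p.WellFormed B))

/-- An upper bound for the running time if all loop bounds are at most `N`. -/
def time (N : ℕ) : Code → ℕ
  | skip => 1
  | assign _ e => e.cost + 1
  | store _ i e => i.cost + e.cost + 1
  | seq p q => p.time N + q.time N
  | branch b p q => b.cost + (p.time N + q.time N)
  | count _ _ p => N * (p.time N + 8) + 6

/-- The nesting depth of loops. -/
def depth : Code → ℕ
  | skip => 0
  | assign _ _ => 0
  | store _ _ _ => 0
  | seq p q => max p.depth q.depth
  | branch _ p q => max p.depth q.depth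
  | count _ _ p => p.depth + 1

/-- The running time is a polynomial in the loop bound whose degree is the nesting depth, so the
cubic bound reduces to computing `depth`. Powers of `N + 1` rather than `N` keep constant costs
covered at `N = 0`. -/
theorem exists_time_le (p : Code) : ∃ K, ∀ N, p.time N ≤ K * (N + 1) ^ p.depth := by
  induction p with
  | skip => exact ⟨1, fun N => by simp [time, depth]⟩
  | assign x e => exact ⟨e.cost + 1, fun N => by simp [time, depth]⟩
  | store a i e => exact ⟨i.cost + e.cost + 1, fun N => by simp [time, depth]⟩
  | seq p q hp hq =>
    obtain ⟨K, hK⟩ := hp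
    obtain ⟨L, hL⟩ := hq
    refine ⟨K + L, fun N => ?_⟩
    calc p.time N + q.time N ≤ K * (N + 1) ^ p.depth + L * (N + 1) ^ q.depth :=
          add_le_add (hK N) (hL N)
      _ ≤ K * (N + 1) ^ max p.depth q.depth + L * (N + 1) ^ max p.depth q.depth := by
          gcongr <;> simp
      _ = (K + L) * (N + 1) ^ max p.depth q.depth := by ring
  | branch b p q hp hq =>
    obtain ⟨K, hK⟩ := hp
    obtain ⟨L, hL⟩ := hq
    refine ⟨b.cost + (K + L), fun N => ?_⟩
    calc b.cost + (p.time N + q.time N)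
        ≤ b.cost * 1 + (K * (N + 1) ^ p.depth + L * (N + 1) ^ q.depth) := by
          rw [mul_one]; exact add_le_add le_rfl (add_le_add (hK N) (hL N))
      _ ≤ b.cost * (N + 1) ^ max p.depth q.depth + (K * (N + 1) ^ max p.depth q.depth
            + L * (N + 1) ^ max p.depth q.depth) := by
          gcongr <;> first | exact Nat.one_le_pow _ _ (by omega) | simp
      _ = (b.cost + (K + L)) * (N + 1) ^ max p.depth q.depth := by ring
  | count x b p hp =>
    obtain ⟨K, hK⟩ := hp
    -- 14 = 8 + 6: the overhead of each round plus that of entering and leaving the loop.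
    refine ⟨K + 14, fun N => ?_⟩
    have h1 : 1 ≤ (N + 1) ^ p.depth := Nat.one_le_pow _ _ (by omega)
    calc N * (p.time N + 8) + 6
        ≤ N * (K * (N + 1) ^ p.depth + 8 * (N + 1) ^ p.depth) + 6 * (N + 1) ^ p.depth := by
          gcongr
          · exact hK N
          · omega
          · omega
      _ ≤ (K + 14) * (N + 1) ^ (p.depth + 1) := by
          rw [pow_succ]
          generalize (N + 1) ^ p.depth = A at *
          nlinarith [Nat.zero_le (N * A), Nat.zero_le (K * A)]

theorem WellFormed.notMem_writes {B : List ℕ} {p : Code} (h : p.WellFormed B) {y : ℕ}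
    (hy : y ∈ B) : y ∉ p.writes := by
  induction p with
  | skip => simp [writes]
  | assign x e => simp only [writes, List.mem_singleton]; rintro rfl; exact h hy
  | store a i e => simp [writes]
  | seq p q hp hq => simp [writes, hp h.1, hq h.2]
  | branch b p q hp hq => simp [writes, hp h.1, hq h.2]
  | count x b p hp =>
    simp only [writes, List.mem_cons, not_or]
    exact ⟨by rintro rfl; exact h.2.1 hy, hp h.2.2.2⟩

end Code

/-! ### Frames: what a program leaves unchanged -/

/-- The state `s'` agrees with `s` outside the variables `W` and the arrays `A`. -/
structure Frame (W A : List ℕ) (s s' : State) : Prop where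
  var : ∀ y, y ∉ W → s'.var y = s.var y
  arr : ∀ a, a ∉ A → s'.arr a = s.arr a

@[simp] theorem State.setVar_var (s : State) (x : ℕ) (v : ℤ) :
    (s.setVar x v).var = Function.update s.var x v := rfl

@[simp] theorem State.setVar_arr (s : State) (x : ℕ) (v : ℤ) : (s.setVar x v).arr = s.arr := rfl

@[simp] theorem State.setArr_var (s : State) (a : ℕ) (i v : ℤ) : (s.setArr a i v).var = s.var := rfl

@[simp] theorem State.setArr_arr (s : State) (a : ℕ) (i v : ℤ) :
    (s.setArr a i v).arr = Function.update s.arr a (Function.update (s.arr a) i v) := rfl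

theorem Frame.loopState {f : State → State} {W A : List ℕ} (hf : ∀ s, Frame W A s (f s)) (x : ℕ)
    (s : State) (k : ℕ) : Frame (x :: W) A s (loopState f x s k) := by
  induction k with
  | zero =>
    refine ⟨fun y hy => ?_, fun a _ => rfl⟩
    simp only [List.mem_cons, not_or] at hy
    simp [TallSmall.loopState, hy.1]
  | succ k ih =>
    refine ⟨fun y hy => ?_, fun a ha => ?_⟩
    · have hy' := hy
      simp only [List.mem_cons, not_or] at hy
      simp [TallSmall.loopState, hy.1, (hf _).var y hy.2, ih.var y hy']
    · simp [TallSmall.loopState, (hf _).arr a ha, ih.arr a ha]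

namespace Code

/-- The write sets are syntactic, so for concrete programs the claim that a variable or array is
untouched is settled by `decide`. -/
theorem frame (p : Code) (s : State) : Frame p.writes p.stores s (p.run s) := by
  induction p generalizing s with
  | skip => exact ⟨fun _ _ => rfl, fun _ _ => rfl⟩
  | assign x e =>
    refine ⟨fun y hy => ?_, fun _ _ => rfl⟩
    simp only [writes, List.mem_singleton] at hy
    simp [run, hy]
  | store a i e =>
    refine ⟨fun _ _ => rfl, fun b hb => ?_⟩
    simp only [stores, List.mem_singleton] at hb
    simp [run, hb]
  | seq p q hp hq =>
    refine ⟨fun y hy => ?_, fun b hb => ?_⟩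
    · simp only [writes, List.mem_append, not_or] at hy
      simp [run, (hq _).var y hy.2, (hp _).var y hy.1]
    · simp only [stores, List.mem_append, not_or] at hb
      simp [run, (hq _).arr b hb.2, (hp _).arr b hb.1]
  | branch b p q hp hq =>
    refine ⟨fun y hy => ?_, fun b hb => ?_⟩
    · simp only [writes, List.mem_append, not_or] at hy
      simp only [run]
      split_ifs
      · exact (hp _).var y hy.1
      · exact (hq _).var y hy.2
    · simp only [stores, List.mem_append, not_or] at hb
      simp only [run]
      split_ifs
      · exact (hp _).arr b hb.1
      · exact (hq _).arr b hb.2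
  | count x b p hp => exact Frame.loopState hp x s _

theorem run_var (p : Code) (s : State) {y : ℕ} (h : y ∉ p.writes) : (p.run s).var y = s.var y :=
  (p.frame s).var y h

/-- The invariant rule for counting loops. -/
theorem run_count {x b : ℕ} {p : Code} {s : State} (Inv : ℕ → State → Prop) {n : ℕ}
    (hn : s.var b = n) (h0 : Inv 0 (s.setVar x 0))
    (hs : ∀ k, k < n → ∀ s' : State, s'.var x = k → Frame (x :: p.writes) p.stores s s' →
      Inv k s' → Inv (k + 1) ((p.run s').setVar x (k + 1))) :
    Inv n ((count x b p).run s) := by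
  have key : ∀ k, k ≤ n → Inv k (loopState p.run x s k) := by
    intro k
    induction k with
    | zero => exact fun _ => h0
    | succ k ih =>
      intro hk
      refine hs k (by omega) _ ?_ (Frame.loopState p.frame x s k) (ih (by omega))
      cases k <;> simp [loopState]
  have : (s.var b).toNat = n := by simp [hn]
  simpa [run, this] using key n le_rfl

/-- The invariant rule for two nested counting loops. -/
theorem run_count_count {x y b : ℕ} {p : Code} {s : State} (Inv : ℕ → ℕ → State → Prop) {n : ℕ}
    (hn : s.var b = n) (hb : b ∉ x :: y :: p.writes) (hx : x ∉ y :: p.writes)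
    (hsetx : ∀ i j s v, Inv i j s → Inv i j (s.setVar x v))
    (hsety : ∀ i j s v, Inv i j s → Inv i j (s.setVar y v))
    (hnext : ∀ i s, Inv i n s → Inv (i + 1) 0 s) (h0 : Inv 0 0 s)
    (hs : ∀ i, i < n → ∀ j, j < n → ∀ s' : State, s'.var x = i → s'.var y = j →
      Frame (x :: y :: p.writes) p.stores s s' → Inv i j s' → Inv i (j + 1) (p.run s')) :
    Inv n 0 ((count x b (count y b p)).run s) := by
  refine run_count (fun i => Inv i 0) hn (hsetx _ _ _ _ h0) fun i hi s' hsx hf h => ?_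
  refine hsetx _ _ _ _ (hnext _ _ ?_)
  refine run_count (fun j => Inv i j) ?_ (hsety _ _ _ _ h) fun j hj s'' hsy hf' h' =>
    hsety _ _ _ _ (hs i hi j hj s'' ?_ hsy ⟨fun z hz => ?_, fun a ha => ?_⟩ h')
  · rw [hf.var b hb, hn]
  · rw [hf'.var x hx, hsx]
  · rw [hf'.var z (fun h => hz (List.mem_cons_of_mem _ h)), hf.var z hz]
  · rw [hf'.arr a ha, hf.arr a ha]

/-! ### Agreement of `run` with execution on the machine -/

/-- Induction on the number `d` of remaining rounds. The bound is never written and the counter only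
by the loop itself, so the test before round `k` compares `k` with the initial bound. A round costs
4 for the test and 4 for the increment besides the body; the failing last test costs 4. -/
theorem exec_loop {x b : ℕ} {p : Code} {B : List ℕ} {N : ℕ}
    (h : (count x b p).WellFormed B)
    (ih : ∀ s : State, (∀ y ∈ B, s.var y ≤ N) →
      ∃ t ≤ p.time N, Exec p.toProgram s (p.run s) t) {s : State}
    (hs : ∀ y ∈ B, s.var y ≤ N) (d k : ℕ) (hd : d + k = (s.var b).toNat) :
    ∃ t ≤ d * (p.time N + 8) + 4, Exec (.loop (.neg (.le (.var b) (.var x)))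
      (.seq p.toProgram (.assign x (.add (.var x) (.const 1)))))
      (loopState p.run x s k) (loopState p.run x s (s.var b).toNat) t := by
  obtain ⟨hbB, hxB, hxp, hp⟩ := h
  have hframe : ∀ y ∈ B, ∀ k, (loopState p.run x s k).var y = s.var y := fun y hy k =>
    (Frame.loopState p.frame x s k).var y (by
      simp only [List.mem_cons, not_or]
      exact ⟨by rintro rfl; exact hxB hy, hp.notMem_writes hy⟩)
  have hx : ∀ k : ℕ, (loopState p.run x s k).var x = k := by
    intro k; cases k <;> simp [loopState]
  induction d generalizing k with
  | zero =>
    refine ⟨_, ?_, by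
      rw [← hd, zero_add]
      refine Exec.loop_false ?_
      simp only [Test.Holds, Expr.eval, not_not, hx, hframe b hbB]
      omega⟩
    simp [Test.cost, Expr.cost]
  | succ d ihd =>
    obtain ⟨t, ht, hE⟩ := ih (loopState p.run x s k) (fun y hy => by
      rw [hframe y hy]; exact hs y hy)
    obtain ⟨t', ht', hE'⟩ := ihd (k + 1) (by omega)
    have hnext : ((p.run (loopState p.run x s k)).setVar x
        ((Expr.add (.var x) (.const 1)).eval (p.run (loopState p.run x s k))))
        = loopState p.run x s (k + 1) := by
      simp [loopState, Expr.eval, p.run_var _ hxp, hx]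
    rw [← hnext] at hE'
    refine ⟨_, ?_, Exec.loop_true (by
      simp only [Test.Holds, Expr.eval, hx, hframe b hbB]
      omega) (Exec.seq hE (Exec.assign _ _ _)) hE'⟩
    have : (d + 1) * (p.time N + 8) + 4 = d * (p.time N + 8) + 4 + (p.time N + 8) := by ring
    simp only [Test.cost, Expr.cost]
    omega

/-- A well-formed program with counting loops halts within the time bound. -/
theorem exec {B : List ℕ} {N : ℕ} {p : Code} (h : p.WellFormed B) {s : State}
    (hs : ∀ y ∈ B, s.var y ≤ N) : ∃ t ≤ p.time N, Exec p.toProgram s (p.run s) t := by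
  induction p generalizing s with
  | skip => exact ⟨1, le_rfl, .skip s⟩
  | assign x e => exact ⟨_, le_rfl, .assign s x e⟩
  | store a i e => exact ⟨_, le_rfl, .store s a i e⟩
  | seq p q hp hq =>
    obtain ⟨t, ht, hE⟩ := hp h.1 hs
    obtain ⟨t', ht', hE'⟩ := hq h.2 (s := p.run s) (fun y hy => by
      rw [p.run_var s (h.1.notMem_writes hy)]; exact hs y hy)
    exact ⟨_, add_le_add ht ht', .seq hE hE'⟩
  | branch b p q hp hq =>
    by_cases hb : b.Holds s
    · obtain ⟨t, ht, hE⟩ := hp h.1 hs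
      refine ⟨b.cost + t, by simp only [time]; omega, ?_⟩
      simpa [run, toProgram, hb] using Exec.branch_true hb hE
    · obtain ⟨t, ht, hE⟩ := hq h.2 hs
      refine ⟨b.cost + t, by simp only [time]; omega, ?_⟩
      simpa [run, toProgram, hb] using Exec.branch_false hb hE
  | count x b p hp =>
    obtain ⟨t, ht, hE⟩ := exec_loop h (fun s hs => hp h.2.2.2 hs) hs (s.var b).toNat 0 rfl
    refine ⟨2 + t, ?_, .seq (.assign _ _ _) hE⟩
    have : (s.var b).toNat ≤ N := by have := hs b h.1; omega
    have := Nat.mul_le_mul_right (p.time N + 8) this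
    simp only [time]
    omega

end Code

/-! ## Longest paths -/

/-- One round of the Floyd-Warshall algorithm keeps the triangle inequalities through the nodes
treated before and adds those through the node `k`. -/
theorem floydWarshall_step {N k : ℕ} {D E : ℕ → ℕ → ℤ} (hk : k < N) (hkk : D k k ≤ 0)
    (hE : ∀ i < N, ∀ j < N, E i j = max (D i j) (D i k + D k j))
    (hD : ∀ l < k, ∀ i < N, ∀ j < N, D i l + D l j ≤ D i j) :
    ∀ l < k + 1, ∀ i < N, ∀ j < N, E i l + E l j ≤ E i j := by
  intro l hl i hi j hj
  have hlN : l < N := by omega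
  rw [hE i hi l hlN, hE l hlN j hj, hE i hi j hj]
  rcases Nat.lt_succ_iff_lt_or_eq.mp hl with hl | rfl
  · have h1 := hD l hl i hi j hj
    have h2 := hD l hl k hk j hj
    have h3 := hD l hl i hi k hk
    have h4 := hD l hl k hk k hk
    omega
  · omega

/-! ## Assigning jobs to positions -/

/-- The number of jobs in `S` of class `κ` at position `p`. -/
def load (S : Finset ℕ) (ty pos : ℕ → ℤ) (κ p : ℤ) : ℕ :=
  (S.filter fun i => ty i = κ ∧ pos i = p).card

theorem load_mono_insert {S : Finset ℕ} {ty pos : ℕ → ℤ} {j : ℕ} (hj : j ∉ S) (p κ q : ℤ) :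
    load S ty pos κ q ≤ load (insert j S) ty (Function.update pos j p) κ q := by
  refine Finset.card_le_card fun i hi => ?_
  simp only [Finset.mem_filter, Finset.mem_insert] at hi ⊢
  have : i ≠ j := by rintro rfl; exact hj hi.1
  simp [this, hi]

theorem load_insert {S : Finset ℕ} {ty pos : ℕ → ℤ} {j : ℕ} (hj : j ∉ S) (p : ℤ) :
    load (insert j S) ty (Function.update pos j p) (ty j) p = load S ty pos (ty j) p + 1 := by
  unfold load
  rw [Finset.filter_insert, if_pos (by simp), Finset.card_insert_of_notMem (by simp [hj])]
  congr 2
  refine Finset.filter_congr fun i hi => ?_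
  have : i ≠ j := by rintro rfl; exact hj hi
  simp [this]

theorem mul_le_card_of_full {S : Finset ℕ} {ty pos : ℕ → ℤ} {κ c a b : ℤ} (hab : a ≤ b)
    (h : ∀ q, a ≤ q → q < b → c ≤ load S ty pos κ q) :
    c * (b - a) ≤ (S.filter fun i => ty i = κ ∧ a ≤ pos i ∧ pos i < b).card := by
  rw [Finset.card_eq_sum_card_fiberwise (f := pos) (t := Finset.Ico a b)
    (fun i hi => by
      have := (Finset.mem_filter.mp hi).2
      simpa using this.2)]
  have : ∀ q ∈ Finset.Ico a b, c ≤
      (((S.filter fun i => ty i = κ ∧ a ≤ pos i ∧ pos i < b).filter fun i => pos i = q).card : ℤ) := by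
    intro q hq
    rw [Finset.mem_Ico] at hq
    refine (h q hq.1 hq.2).trans ?_
    unfold load
    gcongr Nat.cast (Finset.card ?_)
    intro i hi
    simp only [Finset.mem_filter] at hi ⊢
    exact ⟨⟨hi.1, hi.2.1, by omega, by omega⟩, hi.2.2⟩
  have := Finset.card_nsmul_le_sum _ _ _ this
  push_cast
  refine le_trans (le_of_eq ?_) this
  rw [Int.card_Ico, nsmul_eq_mul, Int.toNat_of_nonneg (by omega)]
  ring

/-- A partial assignment of the jobs in `S` to positions and machines built by the greedy
algorithm: every job sits at the first position of its window that was not full. -/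
structure IsGreedy (n : ℕ) (lo hi ty cap : ℕ → ℤ) (S : Finset ℕ) (pos mach : ℕ → ℤ) : Prop where
  sub : ∀ i ∈ S, i < n
  order : ∀ i ∈ S, ∀ j < n, j ∉ S → hi i ≤ hi j
  window : ∀ i ∈ S, lo i ≤ pos i ∧ pos i < hi i
  full : ∀ i ∈ S, ∀ q, lo i ≤ q → q < pos i → cap i ≤ load S ty pos (ty i) q
  machine : ∀ i ∈ S, 0 ≤ mach i ∧ mach i < cap i ∧ mach i < load S ty pos (ty i) (pos i)
  machine_ne : ∀ i ∈ S, ∀ j ∈ S, i ≠ j → ty i = ty j → pos i = pos j → mach i ≠ mach j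

/-- Hall's condition for windows of positions. -/
def Hall (n : ℕ) (lo hi ty cap : ℕ → ℤ) : Prop :=
  ∀ j < n, ∀ p q, p ≤ q →
    (((Finset.range n).filter fun i => ty i = ty j ∧ p ≤ lo i ∧ hi i ≤ q).card : ℤ)
      ≤ cap j * (q - p)

/-- Otherwise the whole window of `j` is full. Extend it to the left to a maximal full interval from
`a` to `hi j`. The jobs in it end by `hi j`, being processed earlier, and start at `a` or later,
since none of them passed the non-full position `a - 1`. Together with `j` they violate Hall's
condition. -/
theorem IsGreedy.lt_hi {n : ℕ} {lo hi ty cap : ℕ → ℤ} {S : Finset ℕ} {pos mach : ℕ → ℤ}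
    (g : IsGreedy n lo hi ty cap S pos mach) (hall : Hall n lo hi ty cap)
    (hcap : ∀ i j, ty i = ty j → cap i = cap j) {j : ℕ} (hj : j < n) (hjS : j ∉ S)
    (hpos : 0 < cap j) (hlohi : lo j ≤ hi j) (hmin : ∀ k < n, k ∉ S → hi j ≤ hi k) {p : ℤ}
    (hfull : ∀ q, lo j ≤ q → q < p → cap j ≤ load S ty pos (ty j) q) : p < hi j := by
  by_contra! hp
  obtain ⟨a, ha, hfa, hna⟩ : ∃ a ≤ lo j, (∀ q, a ≤ q → q < hi j → cap j ≤ load S ty pos (ty j) q) ∧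
      ¬ cap j ≤ load S ty pos (ty j) (a - 1) := by
    by_contra! hcon
    -- If the full stretch never ended on the left, `S.card + 1` full positions would hold more jobs
    -- than `S` has.
    have hall' : ∀ d : ℕ, ∀ q, lo j - d ≤ q → q < hi j → cap j ≤ load S ty pos (ty j) q := by
      intro d
      induction d with
      | zero => exact fun q h1 h2 => hfull q (by simpa using h1) (by omega)
      | succ d ih =>
        intro q h1 h2
        rcases eq_or_lt_of_le h1 with h | h
        · have := hcon (lo j - d) (by omega) ih
          rw [← h]
          convert this using 3
          push_cast; ring
        · exact ih q (by push_cast at h; omega) h2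
    have h1 := mul_le_card_of_full (a := lo j - (S.card + 1 : ℕ)) (b := hi j) (by omega)
      (hall' (S.card + 1))
    have h2 : (S.filter fun i => ty i = ty j ∧ lo j - (S.card + 1 : ℕ) ≤ pos i ∧ pos i < hi j).card
        ≤ S.card := Finset.card_filter_le _ _
    push_cast at h1 h2
    nlinarith
  have h1 := mul_le_card_of_full (ha.trans hlohi) hfa
  have h2 := hall j hj a (hi j) (ha.trans hlohi)
  have h3 : insert j (S.filter fun i => ty i = ty j ∧ a ≤ pos i ∧ pos i < hi j) ⊆
      (Finset.range n).filter fun i => ty i = ty j ∧ a ≤ lo i ∧ hi i ≤ hi j := by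
    intro i hi'
    simp only [Finset.mem_insert, Finset.mem_filter, Finset.mem_range] at hi' ⊢
    rcases hi' with rfl | ⟨hiS, hty, hai, hih⟩
    · exact ⟨hj, rfl, ha, le_rfl⟩
    · refine ⟨g.sub i hiS, hty, ?_, g.order i hiS j hj hjS⟩
      -- A job starting before `a` but placed at or after `a` has skipped `a - 1`, which would
      -- therefore be full.
      by_contra! hlt
      refine hna ?_
      rw [← hty, ← hcap i j hty]
      exact g.full i hiS _ (by omega) (by omega)
  have h4 := Finset.card_le_card h3
  rw [Finset.card_insert_of_notMem (by simp [hjS])] at h4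
  omega

/-- The new job takes as machine number the current load of its position. Earlier jobs there have
smaller numbers, and the load is below the capacity. Loads only grow, so the remaining invariants
survive. -/
theorem IsGreedy.insert {n : ℕ} {lo hi ty cap : ℕ → ℤ} {S : Finset ℕ} {pos mach : ℕ → ℤ}
    (g : IsGreedy n lo hi ty cap S pos mach) (hall : Hall n lo hi ty cap)
    (hcap : ∀ i j, ty i = ty j → cap i = cap j) {j : ℕ} (hj : j < n) (hjS : j ∉ S)
    (hlohi : lo j ≤ hi j) (hmin : ∀ k < n, k ∉ S → hi j ≤ hi k) {p : ℤ} (hp : lo j ≤ p)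
    (hfull : ∀ q, lo j ≤ q → q < p → cap j ≤ load S ty pos (ty j) q)
    (hload : (load S ty pos (ty j) p : ℤ) < cap j) :
    IsGreedy n lo hi ty cap (insert j S) (Function.update pos j p)
      (Function.update mach j (load S ty pos (ty j) p)) := by
  have hpos : 0 < cap j := by omega
  have hlt := g.lt_hi hall hcap hj hjS hpos hlohi hmin hfull
  have hne : ∀ i ∈ S, i ≠ j := by rintro i hi rfl; exact hjS hi
  have hmono : ∀ κ q, (load S ty pos κ q : ℤ) ≤
      load (Insert.insert j S) ty (Function.update pos j p) κ q :=
    fun κ q => by exact_mod_cast load_mono_insert hjS p κ q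
  constructor
  · simp only [Finset.forall_mem_insert]
    exact ⟨hj, g.sub⟩
  · rw [Finset.forall_mem_insert]
    simp only [Finset.mem_insert, not_or]
    exact ⟨fun k hk h => hmin k hk h.2, fun i hi k hk h => g.order i hi k hk h.2⟩
  · simp only [Finset.forall_mem_insert, Function.update_self]
    exact ⟨⟨hp, hlt⟩, fun i hi => by simpa [hne i hi] using g.window i hi⟩
  · simp only [Finset.forall_mem_insert, Function.update_self]
    refine ⟨fun q h1 h2 => (hfull q h1 h2).trans (hmono _ _), fun i hi q h1 h2 => ?_⟩
    rw [Function.update_of_ne (hne i hi)] at h2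
    exact (g.full i hi q h1 h2).trans (hmono _ _)
  · simp only [Finset.forall_mem_insert, Function.update_self]
    refine ⟨⟨by omega, hload, ?_⟩, fun i hi => ?_⟩
    · rw [load_insert hjS]; push_cast; omega
    · rw [Function.update_of_ne (hne i hi), Function.update_of_ne (hne i hi)]
      obtain ⟨h1, h2, h3⟩ := g.machine i hi
      exact ⟨h1, h2, h3.trans_le (hmono _ _)⟩
  · have key : ∀ i ∈ S, ty i = ty j → pos i = p → mach i < load S ty pos (ty j) p := by
      intro i hi h1 h2
      rw [← h1, ← h2]
      exact (g.machine i hi).2.2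
    simp only [Finset.forall_mem_insert, Function.update_self]
    refine ⟨⟨fun h => absurd rfl h, fun i hi _ h1 h2 => ?_⟩,
      fun i hi => ⟨fun _ h1 h2 => ?_, fun k hk h h1 h2 => ?_⟩⟩
    · rw [Function.update_of_ne (hne i hi)] at h2 ⊢
      exact (key i hi h1.symm h2.symm).ne'
    · rw [Function.update_of_ne (hne i hi)] at h2 ⊢
      exact (key i hi h1 h2).ne
    · rw [Function.update_of_ne (hne i hi), Function.update_of_ne (hne k hk)] at h2 ⊢
      exact g.machine_ne i hi k hk h h1 h2

/-! ## The system of difference constraints -/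

/-- The data of an instance, with jobs numbered by natural numbers. -/
structure Jobs where
  num : ℕ
  numSmall : ℕ
  machines : ℤ
  machines_pos : 0 < machines
  release : ℕ → ℤ
  deadline : ℕ → ℤ

namespace Jobs

/-- The class of a job: `0` for small jobs and `1` for tall jobs. -/
def ty (J : Jobs) (j : ℕ) : ℤ := if j < J.numSmall then 0 else 1

/-- The number of jobs of the class of `j` that fit into one slot. -/
def cap (J : Jobs) (j : ℕ) : ℤ := if j < J.numSmall then J.machines else 1

/-- The release times, followed by the deadlines. -/
def tau (J : Jobs) (i : ℕ) : ℤ := if i < J.num then J.release i else J.deadline (i - J.num)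

theorem tau_release (J : Jobs) {j : ℕ} (h : j < J.num) : J.tau j = J.release j := by
  simp [tau, h]

theorem tau_deadline (J : Jobs) (j : ℕ) : J.tau (J.num + j) = J.deadline j := by
  simp [tau]

theorem cap_pos (J : Jobs) (j : ℕ) : 0 < J.cap j := by
  have := J.machines_pos
  unfold cap
  split_ifs <;> omega

theorem cap_eq_of_ty_eq (J : Jobs) {i j : ℕ} (h : J.ty i = J.ty j) : J.cap i = J.cap j := by
  unfold ty at h
  unfold cap
  split_ifs at h ⊢ <;> simp_all

/-- Feasibility of the time slots `slot` and the machines `mach`. -/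
structure Good (J : Jobs) (slot mach : ℕ → ℤ) : Prop where
  window : ∀ j < J.num, J.release j ≤ slot j ∧ slot j + 1 ≤ J.deadline j
  machine : ∀ j < J.num, 0 ≤ mach j ∧ mach j + 1 ≤ J.cap j
  conflict : ∀ i < J.num, ∀ j < J.num, i ≠ j → slot i = slot j →
    J.ty i = 0 ∧ J.ty j = 0 ∧ mach i ≠ mach j

/-- The number of jobs of class `κ` whose window is contained in `[a, b)`. -/
def inside (J : Jobs) (κ a b : ℤ) : ℕ :=
  ((Finset.range J.num).filter fun l => J.ty l = κ ∧ a ≤ J.release l ∧ J.deadline l ≤ b).card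

/-- The difference constraints for the number `y i` of tall slots before the time `tau i`: between
two times there are enough tall slots for the tall jobs, and enough other slots for the small
jobs. -/
def Pot (J : Jobs) (y : ℕ → ℤ) : Prop :=
  ∀ i < 2 * J.num, ∀ j < 2 * J.num,
    (J.tau i ≤ J.tau j → J.inside 1 (J.tau i) (J.tau j) ≤ y j - y i) ∧
    (J.tau j < J.tau i → J.inside 0 (J.tau j) (J.tau i) ≤
      J.machines * (y j - y i + (J.tau i - J.tau j)))

/-- The first position, in the numbering of the slots of its class by `y`, of the window of a
job. -/
def lo (J : Jobs) (y : ℕ → ℤ) (j : ℕ) : ℤ :=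
  if j < J.numSmall then J.release j - y j else y j

/-- The end of the window of positions of a job. -/
def hi (J : Jobs) (y : ℕ → ℤ) (j : ℕ) : ℤ :=
  if j < J.numSmall then J.deadline j - y (J.num + j) else y (J.num + j)

/-! ### Necessity of the constraints, and Hall's condition from them -/

theorem Good.pot {J : Jobs} {slot mach : ℕ → ℤ} (h : J.Good slot mach) :
    J.Pot fun i => (((Finset.range J.num).filter fun l => J.ty l = 1 ∧ slot l < J.tau i).card : ℤ)
    := by
  have key : ∀ a b : ℤ, a ≤ b →
      (((Finset.range J.num).filter fun l => J.ty l = 1 ∧ slot l < b).card : ℤ) =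
      ((Finset.range J.num).filter fun l => J.ty l = 1 ∧ slot l < a).card +
      ((Finset.range J.num).filter fun l => J.ty l = 1 ∧ a ≤ slot l ∧ slot l < b).card := by
    intro a b hab
    rw [← Nat.cast_add, ← Finset.card_union_of_disjoint]
    · congr 2
      ext l
      simp only [Finset.mem_filter, Finset.mem_union]
      constructor
      · rintro ⟨h1, h2, h3⟩
        rcases lt_or_ge (slot l) a with h4 | h4
        · exact .inl ⟨h1, h2, h4⟩
        · exact .inr ⟨h1, h2, h4, h3⟩
      · rintro (⟨h1, h2, h3⟩ | ⟨h1, h2, h3, h4⟩)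
        · exact ⟨h1, h2, by omega⟩
        · exact ⟨h1, h2, h4⟩
    · rw [Finset.disjoint_filter]
      intro l _ h1 h2
      omega
  intro i hi j hj
  refine ⟨fun hij => ?_, fun hji => ?_⟩
  · dsimp only
    rw [key _ _ hij, add_sub_cancel_left]
    unfold inside
    gcongr Nat.cast (Finset.card ?_)
    intro l
    simp only [Finset.mem_filter, Finset.mem_range]
    rintro ⟨h1, h2, h3, h4⟩
    have := h.window l h1
    exact ⟨h1, h2, by omega, by omega⟩
  · dsimp only
    rw [key _ _ hji.le]
    set a := J.tau j
    set b := J.tau i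
    set T := (Finset.range J.num).filter fun l => J.ty l = 1 ∧ a ≤ slot l ∧ slot l < b with hT
    -- Tall jobs have distinct slots, so exactly `b - a - T.card` slots remain; the small jobs
    -- inside inject into remaining slots times machines.
    have hTslot : (T.image slot).card = T.card := by
      refine Finset.card_image_of_injOn fun l hl l' hl' hll => ?_
      by_contra hne
      simp only [hT, Finset.coe_filter, Finset.mem_range, Set.mem_ofPred_eq] at hl hl'
      have := (h.conflict l hl.1 l' hl'.1 hne hll).1
      omega
    have hsub : T.image slot ⊆ Finset.Ico a b := by
      intro u hu
      simp only [hT, Finset.mem_image, Finset.mem_filter] at hu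
      obtain ⟨l, hl, rfl⟩ := hu
      simp [hl.2.2]
    have hfree : ((Finset.Ico a b \ T.image slot).card : ℤ) = b - a - T.card := by
      rw [Finset.card_sdiff_of_subset hsub, hTslot, Int.card_Ico,
        Nat.cast_sub (by rw [← hTslot, ← Int.card_Ico]; exact Finset.card_le_card hsub)]
      omega
    have hinj : J.inside 0 a b ≤
        ((Finset.Ico a b \ T.image slot) ×ˢ Finset.Ico 0 J.machines).card := by
      refine Finset.card_le_card_of_injOn (fun l => (slot l, mach l)) ?_ ?_
      · intro l hl
        simp only [Finset.coe_filter, Finset.mem_range, Set.mem_ofPred_eq] at hl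
        obtain ⟨h1, h2, h3, h4⟩ := hl
        have hw := h.window l h1
        have hm := h.machine l h1
        have hc : J.cap l = J.machines := by
          unfold ty at h2
          unfold cap
          split_ifs at h2 ⊢ <;> omega
        simp only [Finset.coe_product, Finset.coe_sdiff, Set.mem_prod, Set.mem_sdiff,
          Finset.mem_coe, Finset.mem_Ico]
        refine ⟨⟨⟨by omega, by omega⟩, fun hu => ?_⟩, by omega, by omega⟩
        simp only [hT, Finset.mem_image, Finset.mem_filter, Finset.mem_range] at hu
        obtain ⟨l', hl', he⟩ := hu
        have hne : l' ≠ l := by rintro rfl; omega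
        have := (h.conflict l' hl'.1 l h1 hne he).1
        omega
      · intro l hl l' hl' he
        simp only [Finset.coe_filter, Finset.mem_range, Set.mem_ofPred_eq] at hl hl'
        by_contra hne
        rw [Prod.mk.injEq] at he
        exact (h.conflict l hl.1 l' hl'.1 hne he.1).2.2 he.2
    rw [Finset.card_product, Int.card_Ico, sub_zero] at hinj
    have : (J.inside 0 a b : ℤ) ≤ (b - a - T.card) * J.machines := by
      rw [← hfree]
      calc (J.inside 0 a b : ℤ) ≤ _ := Nat.cast_le.mpr hinj
        _ = _ := by rw [Nat.cast_mul, Int.toNat_of_nonneg J.machines_pos.le]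
    refine this.trans (le_of_eq ?_)
    ring

/-- Job counts are nonnegative, so neither the number of tall slots nor that of other slots between
two times is negative. For equal times the first constraint applies in both directions and forces
equal values of `y`. -/
theorem Pot.mono {J : Jobs} {y : ℕ → ℤ} (h : J.Pot y) {i j : ℕ} (hi : i < 2 * J.num)
    (hj : j < 2 * J.num) (hij : J.tau i ≤ J.tau j) :
    0 ≤ y j - y i ∧ 0 ≤ y i - y j + (J.tau j - J.tau i) := by
  have h1 := (h i hi j hj).1 hij
  refine ⟨by omega, ?_⟩
  rcases eq_or_lt_of_le hij with he | hlt
  · have h2 := (h j hj i hi).1 he.ge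
    omega
  · have h2 := (h j hj i hi).2 hlt
    exact nonneg_of_mul_nonneg_right (le_trans (by positivity) h2) J.machines_pos

theorem Pot.lo_le_hi {J : Jobs} {y : ℕ → ℤ} (h : J.Pot y)
    (hw : ∀ j < J.num, J.release j < J.deadline j) {j : ℕ} (hj : j < J.num) :
    J.lo y j ≤ J.hi y j := by
  have h1 := h.mono (i := j) (j := J.num + j) (by omega) (by omega) (by
    rw [J.tau_release hj, J.tau_deadline]; exact (hw j hj).le)
  rw [J.tau_release hj, J.tau_deadline] at h1
  unfold lo hi
  split_ifs <;> omega

/-- Jobs whose position windows lie between `p` and `q` have time windows between their earliest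
release and their latest deadline. The constraint for this pair of times bounds their number by the
capacity times the number of positions in between, which is at most `q - p`. -/
theorem Pot.hall {J : Jobs} {y : ℕ → ℤ} (h : J.Pot y)
    (hw : ∀ j < J.num, J.release j < J.deadline j) :
    Hall J.num (J.lo y) (J.hi y) J.ty J.cap := by
  intro j hj p q hpq
  set S := (Finset.range J.num).filter fun i => J.ty i = J.ty j ∧ p ≤ J.lo y i ∧ J.hi y i ≤ q
    with hS
  rcases S.eq_empty_or_nonempty with he | hne
  · rw [he]
    have := J.cap_pos j
    simp only [Finset.card_empty, Nat.cast_zero]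
    exact mul_nonneg this.le (by omega)
  obtain ⟨a, haS, ha⟩ := S.exists_min_image J.release hne
  obtain ⟨b, hbS, hb⟩ := S.exists_max_image J.deadline hne
  simp only [hS, Finset.mem_filter, Finset.mem_range] at haS hbS
  have hab : J.release a < J.deadline b := (hw a haS.1).trans_le (hb a (by simp [hS, haS]))
  have hsub : S.card ≤ J.inside (J.ty j) (J.release a) (J.deadline b) := by
    refine Finset.card_le_card fun i hi => ?_
    have h1 := ha i hi
    have h2 := hb i hi
    simp only [hS, Finset.mem_filter, Finset.mem_range] at hi ⊢
    exact ⟨hi.1, hi.2.1, h1, h2⟩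
  have hsub' : (S.card : ℤ) ≤ J.inside (J.ty j) (J.release a) (J.deadline b) := by
    exact_mod_cast hsub
  refine hsub'.trans ?_
  obtain ⟨haN, hat, hap, -⟩ := haS
  obtain ⟨hbN, hbt, -, hbq⟩ := hbS
  by_cases hsm : j < J.numSmall
  · have h1 := (h (J.num + b) (by omega) a (by omega)).2
    rw [J.tau_release haN, J.tau_deadline] at h1
    have hlo : J.lo y a = J.release a - y a := by
      simp only [ty, hsm, if_true] at hat
      unfold lo; split_ifs at hat ⊢ <;> omega
    have hhi : J.hi y b = J.deadline b - y (J.num + b) := by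
      simp only [ty, hsm, if_true] at hbt
      unfold hi; split_ifs at hbt ⊢ <;> omega
    simp only [ty, cap, hsm, if_true]
    refine (h1 hab).trans ?_
    exact mul_le_mul_of_nonneg_left (by omega) J.machines_pos.le
  · have h1 := (h a (by omega) (J.num + b) (by omega)).1
    rw [J.tau_release haN, J.tau_deadline] at h1
    have hlo : J.lo y a = y a := by
      simp only [ty, hsm, if_false] at hat
      unfold lo; split_ifs at hat ⊢ <;> omega
    have hhi : J.hi y b = y (J.num + b) := by
      simp only [ty, hsm, if_false] at hbt
      unfold hi; split_ifs at hbt ⊢ <;> omega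
    simp only [ty, cap, hsm, if_false]
    have := h1 hab.le
    omega

/-! ### From a solution of the constraints to disjoint tall and small slots -/

/-- `u` is the tall slot number `p`. -/
def IsTallSlot (J : Jobs) (y : ℕ → ℤ) (p u : ℤ) : Prop :=
  (∀ i < 2 * J.num, p + 1 ≤ y i → u ≤ J.tau i - y i + p) ∧
    ∃ i < 2 * J.num, p + 1 ≤ y i ∧ u = J.tau i - y i + p

/-- `u` is the slot number `p` among those that are not tall. -/
def IsSmallSlot (J : Jobs) (y : ℕ → ℤ) (p u : ℤ) : Prop :=
  (∀ i < 2 * J.num, J.tau i - y i ≤ p → y i + p ≤ u) ∧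
    ∃ i < 2 * J.num, J.tau i - y i ≤ p ∧ u = y i + p

/-- `u` is the slot at the position `p` for the class of the job `j`. -/
def IsSlot (J : Jobs) (y : ℕ → ℤ) (j : ℕ) (p u : ℤ) : Prop :=
  if j < J.numSmall then J.IsSmallSlot y p u else J.IsTallSlot y p u

/-- The time attaining the minimum for `q` is also a candidate for the smaller number `p`. -/
theorem IsTallSlot.lt {J : Jobs} {y : ℕ → ℤ} {p q u v : ℤ} (hu : J.IsTallSlot y p u)
    (hv : J.IsTallSlot y q v) (hpq : p < q) : u < v := by
  obtain ⟨i, hi, h1, h2⟩ := hv.2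
  have := hu.1 i hi (by omega)
  omega

theorem IsSmallSlot.lt {J : Jobs} {y : ℕ → ℤ} {p q u v : ℤ} (hu : J.IsSmallSlot y p u)
    (hv : J.IsSmallSlot y q v) (hpq : p < q) : u < v := by
  obtain ⟨i, hi, h1, h2⟩ := hu.2
  have := hv.1 i hi (by omega)
  omega

/-- Let `i` and `k` attain the minimum and the maximum. If the slots coincided, `i` could not be a
candidate in the maximum nor `k` in the minimum, so `tau i - y i > q` and `y k ≤ p`; then the tall
slot `tau i - y i + p` exceeds `y k + q`. No monotonicity is needed. -/
theorem IsTallSlot.ne {J : Jobs} {y : ℕ → ℤ} {p q u v : ℤ} (hu : J.IsTallSlot y p u)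
    (hv : J.IsSmallSlot y q v) : u ≠ v := by
  rintro rfl
  obtain ⟨i, hi, h1, h2⟩ := hu.2
  obtain ⟨k, hk, h3, h4⟩ := hv.2
  have h5 := hv.1 i hi
  have h6 := hu.1 k hk
  omega

theorem Pot.good {J : Jobs} {y pos slot mach : ℕ → ℤ} (h : J.Pot y)
    (hpos : ∀ j < J.num, J.lo y j ≤ pos j ∧ pos j < J.hi y j)
    (hmach : ∀ j < J.num, 0 ≤ mach j ∧ mach j < J.cap j)
    (hne : ∀ i < J.num, ∀ j < J.num, i ≠ j → J.ty i = J.ty j → pos i = pos j → mach i ≠ mach j)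
    (hslot : ∀ j < J.num, J.IsSlot y j (pos j) (slot j)) : J.Good slot mach := by
  refine ⟨fun j hj => ?_, fun j hj => ?_, fun i hi j hj hij he => ?_⟩
  · have hp := hpos j hj
    have hs := hslot j hj
    have hr := J.tau_release hj
    have hd := J.tau_deadline j
    unfold lo Jobs.hi at hp
    unfold IsSlot at hs
    split_ifs at hp hs with hsm
    · have h1 := hs.1 j (by omega) (by omega)
      refine ⟨by omega, ?_⟩
      -- If `tau i` were at or after the deadline, `tau - y` would put its position beyond `pos j`.
      -- So it is earlier, and monotonicity of `y` bounds the slot.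
      obtain ⟨i, hi, h2, h3⟩ := hs.2
      rcases le_total (J.tau i) (J.tau (J.num + j)) with hle | hle
      · have := h.mono hi (by omega) hle
        omega
      · have := h.mono (by omega) hi hle
        omega
    · have h1 := hs.1 (J.num + j) (by omega) (by omega)
      refine ⟨?_, by omega⟩
      obtain ⟨i, hi, h2, h3⟩ := hs.2
      rcases le_total (J.tau i) (J.tau j) with hle | hle
      · have := h.mono hi (by omega) hle
        omega
      · have := h.mono (by omega) hi hle
        omega
  · have := hmach j hj
    omega
  · have hsi := hslot i hi
    have hsj := hslot j hj
    have hm := hne i hi j hj hij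
    have hmi := hmach i hi
    have hmj := hmach j hj
    rw [he] at hsi
    unfold IsSlot at hsi hsj
    unfold ty at hm ⊢
    unfold cap at hmi hmj
    split_ifs at * with h1 h2 h2
    · refine ⟨rfl, rfl, hm rfl ?_⟩
      rcases lt_trichotomy (pos i) (pos j) with h | h | h
      · exact absurd (hsi.lt hsj h) (lt_irrefl _)
      · exact h
      · exact absurd (hsj.lt hsi h) (lt_irrefl _)
    · exact absurd rfl (hsj.ne hsi)
    · exact absurd rfl (hsi.ne hsj)
    · exfalso
      rcases lt_trichotomy (pos i) (pos j) with h | h | h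
      · exact absurd (hsi.lt hsj h) (lt_irrefl _)
      · exact hm rfl h (by omega)
      · exact absurd (hsj.lt hsi h) (lt_irrefl _)

end Jobs

/-! ## The parts of the program

The variables `4` and `5` hold the number `n` of jobs and `2 * n`, the variables `6`, `7`, `8` are
loop counters, and the variables from `9` on are scratch space. The arrays are: `0` and `1`, release
times and deadlines; `2` and `3`, the schedule; `4`, the times `tau`; `5`, the classes of the jobs;
`6`, their capacities; `7`, the offsets of the rows of a square matrix; `8`, this matrix; `9`, the
marks of the jobs that have been assigned; `10`, their positions; `11` and `12`, the windows of
positions. -/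

infixr:60 " ⨾ " => Code.seq

/-- The inputs of an instance are in the memory. -/
structure HasInput (J : Jobs) (s : State) : Prop where
  numSmall : s.var 0 = J.numSmall
  machines : s.var 2 = J.machines
  num : s.var 4 = J.num
  twice : s.var 5 = (2 * J.num : ℕ)
  release : ∀ j < J.num, s.arr 0 j = J.release j
  deadline : ∀ j < J.num, s.arr 1 j = J.deadline j

theorem HasInput.frame {J : Jobs} {s s' : State} {W A : List ℕ} (h : HasInput J s)
    (hf : Frame W A s s') (hW : 0 ∉ W ∧ 2 ∉ W ∧ 4 ∉ W ∧ 5 ∉ W) (hA : 0 ∉ A ∧ 1 ∉ A) :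
    HasInput J s' where
  numSmall := by rw [hf.var 0 hW.1, h.numSmall]
  machines := by rw [hf.var 2 hW.2.1, h.machines]
  num := by rw [hf.var 4 hW.2.2.1, h.num]
  twice := by rw [hf.var 5 hW.2.2.2, h.twice]
  release := by rw [hf.arr 0 hA.1]; exact h.release
  deadline := by rw [hf.arr 1 hA.2]; exact h.deadline

/-- The tables of times, classes and capacities have been computed. -/
structure HasTables (J : Jobs) (s : State) : Prop extends HasInput J s where
  tau : ∀ i < 2 * J.num, s.arr 4 i = J.tau i
  ty : ∀ j < J.num, s.arr 5 j = J.ty j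
  cap : ∀ j < J.num, s.arr 6 j = J.cap j

theorem HasTables.frame {J : Jobs} {s s' : State} {W A : List ℕ} (h : HasTables J s)
    (hf : Frame W A s s') (hW : 0 ∉ W ∧ 2 ∉ W ∧ 4 ∉ W ∧ 5 ∉ W)
    (hA : 0 ∉ A ∧ 1 ∉ A ∧ 4 ∉ A ∧ 5 ∉ A ∧ 6 ∉ A) : HasTables J s' where
  toHasInput := h.toHasInput.frame hf hW ⟨hA.1, hA.2.1⟩
  tau := by rw [hf.arr 4 hA.2.2.1]; exact h.tau
  ty := by rw [hf.arr 5 hA.2.2.2.1]; exact h.ty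
  cap := by rw [hf.arr 6 hA.2.2.2.2]; exact h.cap

/-- The body of the loop in `tablesCode`. -/
def tablesBody : Code :=
  .store 4 (.var 6) (.read 0 (.var 6)) ⨾
  .store 4 (.add (.var 4) (.var 6)) (.read 1 (.var 6)) ⨾
  .branch (.le (.add (.var 6) (.const 1)) (.var 0))
    (.store 5 (.var 6) (.const 0) ⨾ .store 6 (.var 6) (.var 2))
    (.store 5 (.var 6) (.const 1) ⨾ .store 6 (.var 6) (.const 1))

/-- Computes the tables of times, classes and capacities. -/
def tablesCode : Code := .count 6 4 tablesBody

theorem tablesCode_run {J : Jobs} {s : State} (h : HasInput J s) :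
    HasTables J (tablesCode.run s) := by
  have key := Code.run_count (x := 6) (b := 4)
    (p := tablesBody) (s := s)
    (fun k s' => (∀ j < k, s'.arr 4 j = J.release j ∧
      s'.arr 4 (J.num + j : ℕ) = J.deadline j ∧ s'.arr 5 j = J.ty j ∧ s'.arr 6 j = J.cap j))
    h.num (by simp) (by
      intro k hk s' hx hf ih j hj
      have hi := h.frame hf (by decide) (by decide)
      have h0 := hi.release k hk
      have h1 := hi.deadline k hk
      rcases Nat.lt_succ_iff_lt_or_eq.mp hj with hj | rfl
      · obtain ⟨i1, i2, i3, i4⟩ := ih j hj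
        rw [Nat.cast_add] at i2
        have e1 : j ≠ k := by omega
        have e2 : (j : ℤ) ≠ J.num + k := by omega
        have e3 : (J.num : ℤ) + j ≠ k := by omega
        by_cases hlt : k < J.numSmall <;>
          simp [tablesBody, Code.run, Test.Holds, Expr.eval, hx, hi.num, hi.numSmall, hlt, e1, e2, e3,
            i1, i2, i3, i4]
      · have e1 : (j : ℤ) ≠ J.num + j := by omega
        by_cases hlt : j < J.numSmall <;>
          simp [tablesBody, Code.run, Test.Holds, Expr.eval, hx, hi.num, hi.numSmall, hi.machines,
            hlt, e1, h0, h1, Jobs.ty, Jobs.cap])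
  refine ⟨h.frame (tablesCode.frame s) (by decide) (by decide), fun i hi => ?_,
    fun j hj => (key j hj).2.2.1, fun j hj => (key j hj).2.2.2⟩
  by_cases hin : i < J.num
  · rw [J.tau_release hin]
    exact (key i hin).1
  · obtain ⟨j, rfl⟩ : ∃ j, i = J.num + j := ⟨i - J.num, by omega⟩
    rw [J.tau_deadline]
    exact (key j (by omega)).2.1

/-- Computes the offsets of the rows of a square matrix. -/
def offsetsCode : Code :=
  .assign 9 (.const 0) ⨾
  .count 6 5 (.store 7 (.var 6) (.var 9) ⨾ .assign 9 (.add (.var 9) (.var 5)))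

/-- Row offsets are accumulated by addition, as the machine cannot multiply; matrix addresses are
then a table lookup plus a column. -/
theorem offsetsCode_run {N : ℕ} {s : State} (h : s.var 5 = N) :
    ∀ i < N, (offsetsCode.run s).arr 7 i = (i * N : ℕ) := by
  exact (Code.run_count (x := 6) (b := 5)
    (p := .store 7 (.var 6) (.var 9) ⨾ .assign 9 (.add (.var 9) (.var 5)))
    (s := s.setVar 9 0)
    (fun k s' => s'.var 9 = (k * N : ℕ) ∧ ∀ i < k, s'.arr 7 i = (i * N : ℕ))
    (by simpa using h) (by simp) (by
      rintro k hk s' hx hf ⟨i1, i2⟩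
      have h5 : s'.var 5 = N := by rw [hf.var 5 (by decide)]; simpa using h
      simp only [Code.run, Expr.eval, State.setVar_arr, State.setArr_arr, State.setArr_var,
        State.setVar_var, hx]
      refine ⟨?_, fun i hi => ?_⟩
      · simp [i1, h5]; ring
      · rcases Nat.lt_succ_iff_lt_or_eq.mp hi with hi | rfl
        · have : i ≠ k := by omega
          simp [this, i2 i hi]
        · simp [i1])).2

/-! ### The weights -/

/-- The body of the loop in `insideCode`. -/
def insideBody : Code :=
  .branch (.conj (.eq (.read 5 (.var 8)) (.var 11)) (.conj (.le (.var 9) (.read 0 (.var 8)))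
      (.le (.read 1 (.var 8)) (.var 10))))
    (.branch (.eq (.var 15) (.const 0))
      (.assign 14 (.add (.var 14) (.const 1)) ⨾ .assign 15 (.sub (.var 12) (.const 1)))
      (.assign 15 (.sub (.var 15) (.const 1))))
    .skip

/-- Counts the jobs of class `var 11` with a window contained in `[var 9, var 10)`, in bundles of
`var 12` jobs. -/
def insideCode : Code :=
  .assign 14 (.const 0) ⨾ .assign 15 (.const 0) ⨾ .count 8 4 insideBody

/-- Variable `14` counts the bundles opened and variable `15` the free places in the last one. The
identity makes variable `14` the job count divided by the bundle size, rounded up. -/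
theorem insideCode_run {J : Jobs} {s : State} (h : HasTables J s) (hc : 0 < s.var 12) :
    0 ≤ (insideCode.run s).var 15 ∧ (insideCode.run s).var 15 < s.var 12 ∧
    s.var 12 * (insideCode.run s).var 14 =
      J.inside (s.var 11) (s.var 9) (s.var 10) + (insideCode.run s).var 15 := by
  refine Code.run_count (x := 8) (b := 4) (p := insideBody) (s := (s.setVar 14 0).setVar 15 0)
    (n := J.num) (fun k s' => 0 ≤ s'.var 15 ∧ s'.var 15 < s.var 12 ∧ s.var 12 * s'.var 14 =
      ((Finset.range k).filter fun l => J.ty l = s.var 11 ∧ s.var 9 ≤ J.release l ∧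
        J.deadline l ≤ s.var 10).card + s'.var 15) ?_ ?_ ?_
  · simp [h.num]
  · simp [hc]
  · rintro k hk s' hx hf ⟨i1, i2, i3⟩
    have hi : HasTables J s' := by
      refine h.frame (W := [8, 14, 15]) (A := []) ⟨fun y hy => ?_, fun a ha => ?_⟩
        (by decide) (by decide)
      · simp only [List.mem_cons, List.not_mem_nil, or_false, not_or] at hy
        rw [hf.var y (by simp [insideBody, Code.writes, hy])]
        simp [hy]
      · exact hf.arr a (by simp [insideBody, Code.stores])
    have e9 : s'.var 9 = s.var 9 := by simpa using hf.var 9 (by decide)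
    have e10 : s'.var 10 = s.var 10 := by simpa using hf.var 10 (by decide)
    have e11 : s'.var 11 = s.var 11 := by simpa using hf.var 11 (by decide)
    have e12 : s'.var 12 = s.var 12 := by simpa using hf.var 12 (by decide)
    rw [Finset.range_add_one, Finset.filter_insert]
    by_cases hin : J.ty k = s.var 11 ∧ s.var 9 ≤ J.release k ∧ J.deadline k ≤ s.var 10
    · by_cases h15 : s'.var 15 = 0
      · simp [insideBody, Code.run, Test.Holds, Expr.eval, hx, hi.ty k hk, hi.release k hk,
          hi.deadline k hk, e9, e10, e11, e12, hin, h15, mul_add, i3]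
        omega
      · simp [insideBody, Code.run, Test.Holds, Expr.eval, hx, hi.ty k hk, hi.release k hk,
          hi.deadline k hk, e9, e10, e11, hin, h15, i3]
        omega
    · simp only [insideBody, Code.run, Test.Holds, Expr.eval, hx, hi.ty k hk, hi.release k hk,
          hi.deadline k hk, e9, e10, e11, hin, if_false]
      simp [i1, i2, i3]

/-- The integer `w` is the weight of the pair `(i, j)` in the system of difference constraints. -/
def Jobs.IsWeight (J : Jobs) (i j : ℕ) (w : ℤ) : Prop :=
  ∀ x, w ≤ x ↔ (J.tau i ≤ J.tau j → J.inside 1 (J.tau i) (J.tau j) ≤ x) ∧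
    (J.tau j < J.tau i → J.inside 0 (J.tau j) (J.tau i) ≤
      J.machines * (x + (J.tau i - J.tau j)))

/-- The address of the entry `(i, j)` of a square matrix of size `N`. -/
def cell (N i j : ℕ) : ℤ := (i * N : ℕ) + j

theorem cell_inj {N i j i' j' : ℕ} (hj : j < N) (hj' : j' < N) :
    cell N i j = cell N i' j' ↔ i = i' ∧ j = j' := by
  refine ⟨fun h => ?_, by rintro ⟨rfl, rfl⟩; rfl⟩
  have h' : j + N * i = j' + N * i' := by
    unfold cell at h
    have : i * N + j = i' * N + j' := by exact_mod_cast h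
    linarith
  have h1 := congrArg (· / N) h'
  have h2 := congrArg (· % N) h'
  have hN : 0 < N := by omega
  simp only [Nat.add_mul_div_left _ _ hN, Nat.div_eq_of_lt hj, Nat.div_eq_of_lt hj',
    Nat.add_mul_mod_self_left, Nat.mod_eq_of_lt hj, Nat.mod_eq_of_lt hj'] at h1 h2
  omega

theorem le_iff_of_bundles {c q r k : ℤ} (h0 : 0 ≤ r) (h1 : r < c) (h : c * q = k + r) (x : ℤ) :
    q ≤ x ↔ k ≤ c * x := by
  constructor
  · intro hx
    nlinarith
  · intro hx
    by_contra! hlt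
    nlinarith

/-- Computes the weight of the pair `(var 6, var 7)`. -/
def weightBody : Code :=
  .branch (.le (.read 4 (.var 6)) (.read 4 (.var 7)))
    (.assign 9 (.read 4 (.var 6)) ⨾ .assign 10 (.read 4 (.var 7)) ⨾ .assign 11 (.const 1) ⨾
      .assign 12 (.const 1) ⨾ .assign 13 (.const 0))
    (.assign 9 (.read 4 (.var 7)) ⨾ .assign 10 (.read 4 (.var 6)) ⨾ .assign 11 (.const 0) ⨾
      .assign 12 (.var 2) ⨾ .assign 13 (.sub (.var 10) (.var 9))) ⨾
  insideCode ⨾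
  .store 8 (.add (.read 7 (.var 6)) (.var 7)) (.sub (.var 14) (.var 13))

/-- Computes all weights. -/
def weightsCode : Code := .count 6 5 (.count 7 5 weightBody)

theorem weightBody_run {J : Jobs} {s : State} (h : HasTables J s) {N : ℕ}
    (hr : ∀ i < N, s.arr 7 i = (i * N : ℕ)) (hN : N = 2 * J.num)
    {i j : ℕ} (hi : i < N) (hj : j < N) (h6 : s.var 6 = i) (h7 : s.var 7 = j) :
    ∃ w, J.IsWeight i j w ∧
      (weightBody.run s).arr 8 = Function.update (s.arr 8) (cell N i j) w := by
  have main : ∀ s' : State, Frame [9, 10, 11, 12, 13] [] s s' → 0 < s'.var 12 →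
      ∃ q, (∀ x, q ≤ x ↔
        (J.inside (s'.var 11) (s'.var 9) (s'.var 10) : ℤ) ≤ s'.var 12 * x) ∧
      ((insideCode ⨾ .store 8 (.add (.read 7 (.var 6)) (.var 7)) (.sub (.var 14) (.var 13))).run
        s').arr 8 = Function.update (s.arr 8) (cell N i j) (q - s'.var 13) := by
    intro s' hf hc
    obtain ⟨h1, h2, h3⟩ := insideCode_run (h.frame hf (by decide) (by decide)) hc
    refine ⟨(insideCode.run s').var 14, le_iff_of_bundles h1 h2 h3, ?_⟩
    have hf' := insideCode.frame s'
    have e6 : (insideCode.run s').var 6 = i := by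
      rw [hf'.var 6 (by decide), hf.var 6 (by decide), h6]
    have e7 : (insideCode.run s').var 7 = j := by
      rw [hf'.var 7 (by decide), hf.var 7 (by decide), h7]
    have e13 : (insideCode.run s').var 13 = s'.var 13 := hf'.var 13 (by decide)
    have a7 : (insideCode.run s').arr 7 i = (i * N : ℕ) := by
      rw [hf'.arr 7 (by decide), hf.arr 7 (by decide), hr i hi]
    have a8 : (insideCode.run s').arr 8 = s.arr 8 := by
      rw [hf'.arr 8 (by decide), hf.arr 8 (by decide)]
    simp only [Code.run, Expr.eval, State.setArr_arr, Function.update_self, e6, e7, e13, a7, a8]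
    rfl
  have t6 : s.arr 4 i = J.tau i := h.tau i (by omega)
  have t7 : s.arr 4 j = J.tau j := h.tau j (by omega)
  by_cases hle : J.tau i ≤ J.tau j
  · obtain ⟨q, hq, he⟩ := main
      (((((s.setVar 9 (J.tau i)).setVar 10 (J.tau j)).setVar 11 1).setVar 12 1).setVar 13 0)
      ⟨fun y hy => by
        simp only [List.mem_cons, List.not_mem_nil, or_false, not_or] at hy
        simp [hy], fun _ _ => rfl⟩ (by simp)
    refine ⟨q, fun x => ?_, ?_⟩
    · rw [hq]
      simp [hle, hle.not_gt]
    · refine Eq.trans ?_ (he.trans (by simp))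
      simp [weightBody, Code.run, Test.Holds, Expr.eval, h6, h7, t6, t7, hle]
  · obtain ⟨q, hq, he⟩ := main
      (((((s.setVar 9 (J.tau j)).setVar 10 (J.tau i)).setVar 11 0).setVar 12 (J.machines)).setVar
        13 (J.tau i - J.tau j))
      ⟨fun y hy => by
        simp only [List.mem_cons, List.not_mem_nil, or_false, not_or] at hy
        simp [hy], fun _ _ => rfl⟩ (by simp [J.machines_pos])
    refine ⟨q - (J.tau i - J.tau j), fun x => ?_, ?_⟩
    · rw [sub_le_iff_le_add, hq]
      simp [hle, not_le.mp hle]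
    · refine Eq.trans ?_ (he.trans (by simp))
      simp [weightBody, Code.run, Test.Holds, Expr.eval, h6, h7, t6, t7, hle, h.machines]

theorem weightsCode_run {J : Jobs} {s : State} (h : HasTables J s) {N : ℕ}
    (hr : ∀ i < N, s.arr 7 i = (i * N : ℕ)) (hN : N = 2 * J.num) :
    ∀ i < N, ∀ j < N, J.IsWeight i j ((weightsCode.run s).arr 8 (cell N i j)) := by
  have key := Code.run_count_count (x := 6) (y := 7) (b := 5) (p := weightBody) (s := s) (n := N)
    (fun i j s' => ∀ i' < N, ∀ j' < N, (i' < i ∨ i' = i ∧ j' < j) →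
      J.IsWeight i' j' (s'.arr 8 (cell N i' j')))
    (by rw [h.twice, hN]) (by decide) (by decide)
    (fun _ _ _ _ h => h) (fun _ _ _ _ h => h)
    (fun i s h i' hi' j' hj' hlt => h i' hi' j' hj' (by omega))
    (fun i' _ j' _ h => by omega) (by
      intro i hi j hj s' h6 h7 hf ih i' hi' j' hj' hlt
      obtain ⟨w, hw, he⟩ := weightBody_run (h.frame hf (by decide) (by decide))
        (by rw [hf.arr 7 (by decide)]; exact hr) hN hi hj h6 h7
      rw [he]
      by_cases hc : i' = i ∧ j' = j
      · rw [hc.1, hc.2, Function.update_self]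
        exact hw
      · rw [Function.update_of_ne (by rw [Ne, cell_inj hj' hj]; exact hc)]
        exact ih i' hi' j' hj' (by omega))
  exact fun i hi j hj => key i hi j hj (.inl hi)

/-- A weight is the least admissible difference, so longest paths can be applied to the system. -/
theorem Jobs.pot_iff {J : Jobs} {w : ℕ → ℕ → ℤ}
    (hw : ∀ i < 2 * J.num, ∀ j < 2 * J.num, J.IsWeight i j (w i j)) (y : ℕ → ℤ) :
    J.Pot y ↔ ∀ i < 2 * J.num, ∀ j < 2 * J.num, w i j ≤ y j - y i := by
  unfold Jobs.Pot
  refine forall_congr' fun i => forall_congr' fun hi => forall_congr' fun j => forall_congr'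
    fun hj => ?_
  rw [hw i hi j hj]

/-! ### Longest paths -/

/-- Replaces the entry `(var 7, var 8)` by its maximum with the length of a path through
`var 6`. -/
def relaxBody : Code :=
  .assign 9 (.add (.read 8 (.add (.read 7 (.var 7)) (.var 6)))
    (.read 8 (.add (.read 7 (.var 6)) (.var 8)))) ⨾
  .branch (.le (.read 8 (.add (.read 7 (.var 7)) (.var 8))) (.var 9))
    (.store 8 (.add (.read 7 (.var 7)) (.var 8)) (.var 9)) .skip

/-- The Floyd-Warshall algorithm. -/
def pathsCode : Code := .count 6 5 (.count 7 5 (.count 8 5 relaxBody))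

theorem relaxBody_run {s : State} {N i j k : ℕ} (hr : ∀ i < N, s.arr 7 i = (i * N : ℕ))
    (hi : i < N) (hk : k < N) (h6 : s.var 6 = k) (h7 : s.var 7 = i) (h8 : s.var 8 = j) :
    (relaxBody.run s).arr 8 = Function.update (s.arr 8) (cell N i j)
      (max (s.arr 8 (cell N i j)) (s.arr 8 (cell N i k) + s.arr 8 (cell N k j))) := by
  have h1 := hr i hi
  have h2 := hr k hk
  by_cases hle : s.arr 8 (cell N i j) ≤ s.arr 8 (cell N i k) + s.arr 8 (cell N k j)
  · have := hle
    unfold cell at this ⊢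
    simp only [relaxBody, Code.run, Test.Holds, Expr.eval, State.setVar_var, State.setVar_arr,
      Function.update_self, ne_eq, Nat.reduceEqDiff, not_false_eq_true, Function.update_of_ne, h6,
      h7, h8, h1, h2, this, if_true, State.setArr_arr, max_eq_right]
  · have h3 := hle
    rw [max_eq_left (not_le.mp hle).le, Function.update_eq_self]
    unfold cell at h3
    simp only [relaxBody, Code.run, Test.Holds, Expr.eval, State.setVar_var, State.setVar_arr,
      Function.update_self, ne_eq, Nat.reduceEqDiff, not_false_eq_true, Function.update_of_ne, h6,
      h7, h8, h1, h2, h3, if_false]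

/-- The matrix is updated in place. This is harmless because a nonpositive diagonal entry at `k`
leaves row `k` and column `k` unchanged during the round. -/
theorem relaxRound_run {s : State} {N k : ℕ} (h5 : s.var 5 = N)
    (hr : ∀ i < N, s.arr 7 i = (i * N : ℕ)) (hk : k < N) (h6 : s.var 6 = k)
    (hkk : s.arr 8 (cell N k k) ≤ 0) :
    ∀ i < N, ∀ j < N, ((Code.count 7 5 (.count 8 5 relaxBody)).run s).arr 8 (cell N i j) =
      max (s.arr 8 (cell N i j)) (s.arr 8 (cell N i k) + s.arr 8 (cell N k j)) := by
  set D := fun i j => s.arr 8 (cell N i j) with hD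
  set E := fun i j => max (D i j) (D i k + D k j) with hE
  have key := Code.run_count_count (x := 7) (y := 8) (b := 5) (p := relaxBody) (s := s) (n := N)
    (fun i j s' => ∀ i' < N, ∀ j' < N, s'.arr 8 (cell N i' j') =
      if i' < i ∨ i' = i ∧ j' < j then E i' j' else D i' j')
    h5 (by decide) (by decide)
    (fun _ _ _ _ h => h) (fun _ _ _ _ h => h)
    (fun i s h i' hi' j' hj' => by
      rw [h i' hi' j' hj']
      refine if_congr ?_ rfl rfl
      omega)
    (fun i' _ j' _ => by simp [hD]) (by
      intro i hi j hj s' h7 h8 hf ih i' hi' j' hj'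
      rw [relaxBody_run (k := k) (by rw [hf.arr 7 (by decide)]; exact hr) hi hk
        (by rw [hf.var 6 (by decide)]; exact h6) h7 h8]
      have hik : s'.arr 8 (cell N i k) = D i k := by
        rw [ih i hi k hk]
        have : D k k ≤ 0 := hkk
        split_ifs
        · simp only [hE]; omega
        · rfl
      have hkj : s'.arr 8 (cell N k j) = D k j := by
        rw [ih k hk j hj]
        have : D k k ≤ 0 := hkk
        split_ifs
        · simp only [hE]; omega
        · rfl
      rw [hik, hkj, ih i hi j hj]
      by_cases hc : i' = i ∧ j' = j
      · rw [hc.1, hc.2, Function.update_self, if_neg (by omega), if_pos (by omega)]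
      · rw [Function.update_of_ne (by rw [Ne, cell_inj hj' hj]; exact hc), ih i' hi' j' hj']
        refine if_congr ?_ rfl rfl
        omega)
  intro i hi j hj
  rw [key i hi j hj, if_pos (.inl hi)]

/-- Any solution `y` bounds all path lengths from above, so diagonal entries stay nonpositive. The
final matrix satisfies all triangle inequalities and dominates the weights, so its row 0 is itself a
solution. -/
theorem pathsCode_run {s : State} {N : ℕ} (h5 : s.var 5 = N)
    (hr : ∀ i < N, s.arr 7 i = (i * N : ℕ)) {y : ℕ → ℤ}
    (hy : ∀ i < N, ∀ j < N, s.arr 8 (cell N i j) ≤ y j - y i) :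
    ∀ i < N, ∀ j < N, s.arr 8 (cell N i j) ≤
      (pathsCode.run s).arr 8 (cell N 0 j) - (pathsCode.run s).arr 8 (cell N 0 i) := by
  have key := Code.run_count (x := 6) (b := 5) (p := .count 7 5 (.count 8 5 relaxBody))
    (s := s) (n := N)
    (fun k s' => (∀ i < N, ∀ j < N, s'.arr 8 (cell N i j) ≤ y j - y i) ∧
      (∀ i < N, ∀ j < N, s.arr 8 (cell N i j) ≤ s'.arr 8 (cell N i j)) ∧
      ∀ l < k, ∀ i < N, ∀ j < N, s'.arr 8 (cell N i l) + s'.arr 8 (cell N l j) ≤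
        s'.arr 8 (cell N i j))
    h5 ⟨hy, fun _ _ _ _ => le_rfl, fun l hl => by omega⟩ (by
      rintro k hk s' h6 hf ⟨i1, i2, i3⟩
      have hkk : s'.arr 8 (cell N k k) ≤ 0 := by simpa using i1 k hk k hk
      have hE := relaxRound_run (s := s') (N := N) (k := k)
        (by rw [hf.var 5 (by decide)]; exact h5)
        (by rw [hf.arr 7 (by decide)]; exact hr) hk h6 hkk
      simp only [State.setVar_arr]
      refine ⟨fun i hi j hj => ?_, fun i hi j hj => ?_,
        floydWarshall_step (D := fun i j => s'.arr 8 (cell N i j)) hk hkk hE i3⟩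
      · rw [hE i hi j hj]
        have h1 := i1 i hi j hj
        have h2 := i1 i hi k hk
        have h3 := i1 k hk j hj
        omega
      · rw [hE i hi j hj]
        exact (i2 i hi j hj).trans (le_max_left _ _))
  obtain ⟨-, h2, h3⟩ := key
  intro i hi j hj
  have h4 := h2 i hi j hj
  have h5 := h3 i hi 0 (by omega) j hj
  unfold pathsCode
  omega

/-! ### Windows of positions -/

/-- The body of the loop in `windowsCode`. -/
def windowsBody : Code :=
  .branch (.eq (.read 5 (.var 6)) (.const 0))
    (.store 11 (.var 6) (.sub (.read 0 (.var 6)) (.read 8 (.var 6))) ⨾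
      .store 12 (.var 6) (.sub (.read 1 (.var 6)) (.read 8 (.add (.var 4) (.var 6)))))
    (.store 11 (.var 6) (.read 8 (.var 6)) ⨾
      .store 12 (.var 6) (.read 8 (.add (.var 4) (.var 6))))

/-- Computes the windows of positions from the first row of the matrix. -/
def windowsCode : Code := .count 6 4 windowsBody

theorem windowsCode_run {J : Jobs} {s : State} (h : HasTables J s) {y : ℕ → ℤ}
    (hy : ∀ i < 2 * J.num, s.arr 8 i = y i) :
    ∀ j < J.num, (windowsCode.run s).arr 11 j = J.lo y j ∧
      (windowsCode.run s).arr 12 j = J.hi y j := by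
  refine Code.run_count (x := 6) (b := 4) (p := windowsBody) (s := s)
    (fun k s' => ∀ j < k, s'.arr 11 j = J.lo y j ∧ s'.arr 12 j = J.hi y j) h.num (by simp) ?_
  intro k hk s' hx hf ih j hj
  have hi := h.frame hf (by decide) (by decide)
  have h1 := hi.ty k hk
  have h2 := hi.release k hk
  have h3 := hi.deadline k hk
  have h4 : s'.arr 8 k = y k := by rw [hf.arr 8 (by decide)]; exact hy k (by omega)
  have h5 : s'.arr 8 (J.num + k) = y (J.num + k) := by
    rw [hf.arr 8 (by decide)]; exact_mod_cast hy (J.num + k) (by omega)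
  rcases Nat.lt_succ_iff_lt_or_eq.mp hj with hj | rfl
  · obtain ⟨i1, i2⟩ := ih j hj
    have e1 : j ≠ k := by omega
    by_cases hlt : J.ty k = 0 <;>
      simp [windowsBody, Code.run, Test.Holds, Expr.eval, hx, hlt, e1, h1, i1, i2]
  · by_cases hlt : j < J.numSmall
    · have h0 : J.ty j = 0 := by simp [Jobs.ty, hlt]
      simp [windowsBody, Code.run, Test.Holds, Expr.eval, hx, h1, h0, h2, h3, h4, h5, hi.num,
        Jobs.lo, Jobs.hi, hlt]
    · have h0 : J.ty j = 1 := by simp [Jobs.ty, hlt]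
      simp [windowsBody, Code.run, Test.Holds, Expr.eval, hx, h1, h0, h4, h5, hi.num,
        Jobs.lo, Jobs.hi, hlt]

/-! ### The greedy assignment -/

/-- The body of the loop in `pickCode`. -/
def pickBody : Code :=
  .branch (.eq (.read 9 (.var 7)) (.const 0))
    (.branch (.eq (.var 9) (.const (-1))) (.assign 9 (.var 7))
      (.branch (.le (.read 12 (.var 9)) (.read 12 (.var 7))) .skip (.assign 9 (.var 7))))
    .skip

/-- Finds an unmarked job whose window ends first. -/
def pickCode : Code := .assign 9 (.const (-1)) ⨾ .count 7 4 pickBody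

theorem pickCode_run {s : State} {n : ℕ} (h4 : s.var 4 = n) (h : ∃ j < n, s.arr 9 (j : ℕ) = 0) :
    ∃ j < n, (pickCode.run s).var 9 = (j : ℕ) ∧ s.arr 9 j = 0 ∧
      ∀ k < n, s.arr 9 (k : ℕ) = 0 → s.arr 12 j ≤ s.arr 12 k := by
  have key := Code.run_count (x := 7) (b := 4) (p := pickBody) (s := s.setVar 9 (-1)) (n := n)
    (fun k s' => (s'.var 9 = -1 ∧ ∀ l < k, s.arr 9 (l : ℕ) ≠ 0) ∨
      ∃ j < k, s'.var 9 = (j : ℕ) ∧ s.arr 9 j = 0 ∧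
        ∀ l < k, s.arr 9 (l : ℕ) = 0 → s.arr 12 j ≤ s.arr 12 l)
    (by simpa using h4) (by simp) (by
      intro k hk s' hx hf ih
      have a9 : s'.arr 9 = s.arr 9 := hf.arr 9 (by decide)
      have a12 : s'.arr 12 = s.arr 12 := hf.arr 12 (by decide)
      by_cases hk0 : s.arr 9 k = 0
      · rcases ih with ⟨i1, i2⟩ | ⟨j, hj, i1, i2, i3⟩
        · refine .inr ⟨k, by omega, ?_, hk0, fun l hl hl0 => ?_⟩
          · simp [pickBody, Code.run, Test.Holds, Expr.eval, hx, a9, hk0, i1]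
          · rcases Nat.lt_succ_iff_lt_or_eq.mp hl with hl | rfl
            · exact absurd hl0 (i2 l hl)
            · exact le_rfl
        · have hne : (j : ℤ) ≠ -1 := by omega
          by_cases hle : s.arr 12 j ≤ s.arr 12 k
          · refine .inr ⟨j, by omega, ?_, i2, fun l hl hl0 => ?_⟩
            · simp [pickBody, Code.run, Test.Holds, Expr.eval, hx, a9, a12, hk0, i1, hne, hle]
            · rcases Nat.lt_succ_iff_lt_or_eq.mp hl with hl | rfl
              · exact i3 l hl hl0
              · exact hle
          · refine .inr ⟨k, by omega, ?_, hk0, fun l hl hl0 => ?_⟩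
            · simp [pickBody, Code.run, Test.Holds, Expr.eval, hx, a9, a12, hk0, i1, hne, hle]
            · rcases Nat.lt_succ_iff_lt_or_eq.mp hl with hl | rfl
              · exact (not_le.mp hle).le.trans (i3 l hl hl0)
              · exact le_rfl
      · have hrun : ((pickBody.run s').setVar 7 (k + 1)).var 9 = s'.var 9 := by
          simp [pickBody, Code.run, Test.Holds, Expr.eval, hx, a9, hk0]
        rw [hrun]
        rcases ih with ⟨i1, i2⟩ | ⟨j, hj, i1, i2, i3⟩
        · refine .inl ⟨i1, fun l hl => ?_⟩
          rcases Nat.lt_succ_iff_lt_or_eq.mp hl with hl | rfl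
          · exact i2 l hl
          · exact hk0
        · refine .inr ⟨j, by omega, i1, i2, fun l hl hl0 => ?_⟩
          rcases Nat.lt_succ_iff_lt_or_eq.mp hl with hl | rfl
          · exact i3 l hl hl0
          · exact absurd hl0 hk0)
  rcases key with ⟨-, h2⟩ | h2
  · obtain ⟨j, hj, hj0⟩ := h
    exact absurd hj0 (h2 j hj)
  · exact h2

/-- The body of the loop in `loadCode`. -/
def loadBody : Code :=
  .branch (.conj (.eq (.read 9 (.var 8)) (.const 1))
      (.conj (.eq (.read 5 (.var 8)) (.read 5 (.var 9))) (.eq (.read 10 (.var 8)) (.var 10))))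
    (.assign 11 (.add (.var 11) (.const 1))) .skip

/-- Counts the marked jobs of the class of `var 9` at the position `var 10`. -/
def loadCode : Code := .assign 11 (.const 0) ⨾ .count 8 4 loadBody

/-- The marks in array `9` describe the set `S`. -/
def Marks (n : ℕ) (S : Finset ℕ) (s : State) : Prop :=
  ∀ i < n, s.arr 9 (i : ℕ) = if i ∈ S then 1 else 0

theorem loadCode_run {J : Jobs} {s : State} (h : HasTables J s) {S : Finset ℕ}
    (hS : ∀ i ∈ S, i < J.num) (hm : Marks J.num S s) {j : ℕ} (hj : j < J.num)
    (h9 : s.var 9 = j) :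
    (loadCode.run s).var 11 = load S J.ty (fun i => s.arr 10 i) (J.ty j) (s.var 10) := by
  have hSr : S = (Finset.range J.num).filter (· ∈ S) := by
    ext i
    simp only [Finset.mem_filter, Finset.mem_range]
    exact ⟨fun hi => ⟨hS i hi, hi⟩, fun hi => hi.2⟩
  have key := Code.run_count (x := 8) (b := 4) (p := loadBody) (s := s.setVar 11 0) (n := J.num)
    (fun k s' => s'.var 11 = ((Finset.range k).filter
      fun i => i ∈ S ∧ J.ty i = J.ty j ∧ s.arr 10 i = s.var 10).card)
    (by simp [h.num]) (by simp) (by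
      intro k hk s' hx hf ih
      have a9 : s'.arr 9 k = if k ∈ S then 1 else 0 := by
        rw [hf.arr 9 (by decide)]; exact hm k hk
      have a5 : s'.arr 5 k = J.ty k := by rw [hf.arr 5 (by decide)]; exact h.ty k hk
      have a5' : s'.arr 5 j = J.ty j := by rw [hf.arr 5 (by decide)]; exact h.ty j hj
      have a10 : s'.arr 10 = s.arr 10 := hf.arr 10 (by decide)
      have v9 : s'.var 9 = j := by rw [hf.var 9 (by decide)]; simpa using h9
      have v10 : s'.var 10 = s.var 10 := by rw [hf.var 10 (by decide)]; simp
      rw [Finset.range_add_one, Finset.filter_insert]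
      by_cases hc : k ∈ S ∧ J.ty k = J.ty j ∧ s.arr 10 k = s.var 10
      · simp [loadBody, Code.run, Test.Holds, Expr.eval, hx, a9, a5, a5', a10, v9, v10, hc, ih]
      · have hc' : ¬ ((if k ∈ S then (1 : ℤ) else 0) = 1 ∧ J.ty k = J.ty j ∧
            s.arr 10 k = s.var 10) := by
          simpa using hc
        simp only [loadBody, Code.run, Test.Holds, Expr.eval, hx, a9, a5, a5', a10, v9, v10, hc,
          hc', if_false]
        simp [ih])
  refine key.trans ?_
  unfold load
  conv_rhs => rw [hSr, Finset.filter_filter]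

/-- The body of the loop in `searchCode`. -/
def searchBody : Code :=
  loadCode ⨾ .branch (.le (.read 6 (.var 9)) (.var 11))
    (.assign 10 (.add (.var 10) (.const 1))) .skip

/-- Finds the first position in the window of the job `var 9` that is not full. -/
def searchCode : Code := .assign 10 (.read 11 (.var 9)) ⨾ .count 7 4 searchBody

/-- The search moves on from full positions and stays at the first one that is not full. As many
rounds as there are jobs suffice, which keeps the bound independent of the window lengths. -/
theorem searchCode_run {J : Jobs} {s : State} (h : HasTables J s) {S : Finset ℕ}
    (hS : ∀ i ∈ S, i < J.num) (hm : Marks J.num S s) {j : ℕ} (hj : j < J.num) (hjS : j ∉ S)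
    (h9 : s.var 9 = j) :
    s.arr 11 j ≤ (searchCode.run s).var 10 ∧
    (∀ q, s.arr 11 j ≤ q → q < (searchCode.run s).var 10 →
      J.cap j ≤ load S J.ty (fun i => s.arr 10 i) (J.ty j) q) ∧
    (searchCode.run s).var 11 =
      load S J.ty (fun i => s.arr 10 i) (J.ty j) ((searchCode.run s).var 10) ∧
    (load S J.ty (fun i => s.arr 10 i) (J.ty j) ((searchCode.run s).var 10) : ℤ) < J.cap j := by
  have key := Code.run_count (x := 7) (b := 4) (p := searchBody)
    (s := s.setVar 10 (s.arr 11 j)) (n := J.num)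
    (fun k s' => s.arr 11 j ≤ s'.var 10 ∧
      (∀ q, s.arr 11 j ≤ q → q < s'.var 10 →
        J.cap j ≤ load S J.ty (fun i => s.arr 10 i) (J.ty j) q) ∧
      (s'.var 10 = s.arr 11 j + k ∨
        s'.var 11 = load S J.ty (fun i => s.arr 10 i) (J.ty j) (s'.var 10) ∧
        (load S J.ty (fun i => s.arr 10 i) (J.ty j) (s'.var 10) : ℤ) < J.cap j))
    (by simp [h.num]) (by
      simp only [State.setVar_var, Function.update_self, ne_eq, Nat.reduceEqDiff,
        not_false_eq_true, Function.update_of_ne, le_refl, Nat.cast_zero, add_zero, true_or,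
        and_true, true_and]
      intro q h1 h2
      omega) (by
      rintro k hk s' hx hf ⟨i1, i2, i3⟩
      have ht : HasTables J s' := (h.frame ⟨fun y hy => by
        simp only [List.mem_singleton] at hy; simp [hy], fun _ _ => rfl⟩
        (W := [10]) (A := []) (by decide) (by decide) : HasTables J (s.setVar 10 (s.arr 11 j))).frame
          hf (by decide) (by decide)
      have v9 : s'.var 9 = j := by rw [hf.var 9 (by decide)]; simpa using h9
      have a10 : s'.arr 10 = s.arr 10 := hf.arr 10 (by decide)
      have hl := loadCode_run ht hS (fun i hi => by rw [hf.arr 9 (by decide)]; exact hm i hi) hj v9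
      rw [a10] at hl
      have hf' := loadCode.frame s'
      have v9' : (loadCode.run s').var 9 = j := by rw [hf'.var 9 (by decide), v9]
      have v10' : (loadCode.run s').var 10 = s'.var 10 := hf'.var 10 (by decide)
      have a6 : (loadCode.run s').arr 6 j = J.cap j := by
        rw [hf'.arr 6 (by decide)]; exact ht.cap j hj
      set L := load S J.ty (fun i => s.arr 10 i) (J.ty j) with hL
      by_cases hfull : J.cap j ≤ L (s'.var 10)
      · have hrun : ((searchBody.run s').setVar 7 (k + 1)).var 10 = s'.var 10 + 1 := by
          simp [searchBody, Code.run, Test.Holds, Expr.eval, v9', v10', a6, hl, hfull]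
        rw [hrun]
        refine ⟨by omega, fun q h1 h2 => ?_, .inl ?_⟩
        · rcases eq_or_lt_of_le (Int.lt_add_one_iff.mp h2) with rfl | h3
          · exact hfull
          · exact i2 q h1 h3
        · rcases i3 with i3 | i3
          · push_cast; omega
          · omega
      · have hrun : searchBody.run s' = loadCode.run s' := by
          simp [searchBody, Code.run, Test.Holds, Expr.eval, v9', a6, hl, hfull]
        rw [hrun]
        have e10 : ((loadCode.run s').setVar 7 (k + 1)).var 10 = s'.var 10 := by simp [v10']
        have e11 : ((loadCode.run s').setVar 7 (k + 1)).var 11 = L (s'.var 10) := by simp [hl]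
        rw [e10, e11]
        exact ⟨i1, i2, .inr ⟨rfl, by omega⟩⟩)
  have hrun : searchCode.run s =
      (Code.count 7 4 searchBody).run (s.setVar 10 (s.arr 11 j)) := by
    simp [searchCode, Code.run, Expr.eval, h9]
  rw [hrun]
  obtain ⟨h1, h2, h3⟩ := key
  refine ⟨h1, h2, ?_⟩
  rcases h3 with h3 | h3
  -- Moving on in every round means `J.num` full positions, holding at least `J.num` jobs of `S`;
  -- but `S` misses `j`.
  · exfalso
    have h4 := mul_le_card_of_full h1 h2
    have h5 := Finset.card_filter_le S fun i => J.ty i = J.ty j ∧ s.arr 11 j ≤ s.arr 10 i ∧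
      s.arr 10 i < ((Code.count 7 4 searchBody).run (s.setVar 10 (s.arr 11 j))).var 10
    have h6 : (insert j S).card ≤ (Finset.range J.num).card := by
      refine Finset.card_le_card fun i hi => ?_
      rw [Finset.mem_range]
      rcases Finset.mem_insert.mp hi with rfl | hi
      · exact hj
      · exact hS i hi
    rw [Finset.card_insert_of_notMem hjS, Finset.card_range] at h6
    have h7 := J.cap_pos j
    have h8 : (J.num : ℤ) ≤ J.cap j * J.num := le_mul_of_one_le_left (by omega) (by omega)
    rw [h3, add_sub_cancel_left] at h4
    rw [h3] at h5
    omega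
  · exact h3

/-- Assigns one job. -/
def assignBody : Code :=
  pickCode ⨾ searchCode ⨾ .store 10 (.var 9) (.var 10) ⨾ .store 3 (.var 9) (.var 11) ⨾
  .store 9 (.var 9) (.const 1)

/-- Assigns all jobs to positions and machines. -/
def greedyCode : Code := .count 6 4 assignBody

theorem update_comp_cast (f : ℤ → ℤ) (j : ℕ) (v : ℤ) :
    (fun i : ℕ => Function.update f (j : ℤ) v (i : ℤ)) =
      Function.update (fun i : ℕ => f i) j v := by
  funext i
  by_cases h : i = j
  · subst h; simp
  · simp [h]

theorem assignBody_run {J : Jobs} {lo hi : ℕ → ℤ} (hall : Hall J.num lo hi J.ty J.cap)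
    (hlohi : ∀ j < J.num, lo j ≤ hi j) {s : State} (h : HasTables J s)
    (hlo : ∀ j < J.num, s.arr 11 j = lo j) (hhi : ∀ j < J.num, s.arr 12 j = hi j)
    {S : Finset ℕ} (hm : Marks J.num S s)
    (hg : IsGreedy J.num lo hi J.ty J.cap S (fun i => s.arr 10 i) (fun i => s.arr 3 i))
    (hS : S.card < J.num) :
    ∃ j, j ∉ S ∧ Marks J.num (insert j S) (assignBody.run s) ∧
      IsGreedy J.num lo hi J.ty J.cap (insert j S) (fun i => (assignBody.run s).arr 10 i)
        (fun i => (assignBody.run s).arr 3 i) := by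
  obtain ⟨j₀, hj₀, hj₀S⟩ : ∃ j < J.num, j ∉ S := by
    by_contra! hcon
    have : Finset.range J.num ⊆ S := fun i hi => hcon i (Finset.mem_range.mp hi)
    have := Finset.card_le_card this
    rw [Finset.card_range] at this
    omega
  obtain ⟨j, hj, hj9, hj0, hmin⟩ := pickCode_run h.num ⟨j₀, hj₀, by simp [hm j₀ hj₀, hj₀S]⟩
  have hjS : j ∉ S := fun hjS => by simp [hm j hj, hjS] at hj0
  have hf := pickCode.frame s
  obtain ⟨h1, h2, h3, h4⟩ := searchCode_run (h.frame hf (by decide) (by decide)) hg.sub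
    (fun i hi => by rw [hf.arr 9 (by decide)]; exact hm i hi) hj hjS hj9
  have hf' := searchCode.frame (pickCode.run s)
  set s₁ := searchCode.run (pickCode.run s) with hs₁
  have v9 : s₁.var 9 = j := by rw [hf'.var 9 (by decide), hj9]
  have a9 : s₁.arr 9 = s.arr 9 := by rw [hf'.arr 9 (by decide), hf.arr 9 (by decide)]
  have a10 : s₁.arr 10 = s.arr 10 := by rw [hf'.arr 10 (by decide), hf.arr 10 (by decide)]
  have a3 : s₁.arr 3 = s.arr 3 := by rw [hf'.arr 3 (by decide), hf.arr 3 (by decide)]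
  rw [hf.arr 10 (by decide)] at h2 h3 h4
  rw [hf.arr 11 (by decide), hlo j hj] at h1 h2
  have hrun : assignBody.run s =
      ((s₁.setArr 10 j (s₁.var 10)).setArr 3 j (s₁.var 11)).setArr 9 j 1 := by
    simp [assignBody, Code.run, Expr.eval, ← hs₁, v9]
  refine ⟨j, hjS, fun i hi => ?_, ?_⟩
  · rw [hrun]
    by_cases hij : i = j
    · simp [hij]
    · simp [hij, a9, hm i hi]
  · have e10 : (fun i : ℕ => (assignBody.run s).arr 10 i) =
        Function.update (fun i : ℕ => s.arr 10 i) j (s₁.var 10) := by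
      rw [← update_comp_cast, hrun]
      simp [a10]
    have e3 : (fun i : ℕ => (assignBody.run s).arr 3 i) =
        Function.update (fun i : ℕ => s.arr 3 i) j (s₁.var 11) := by
      rw [← update_comp_cast, hrun]
      simp [a3]
    rw [e10, e3, h3]
    refine hg.insert hall (fun i j => J.cap_eq_of_ty_eq) hj hjS (hlohi j hj)
      (fun k hk hkS => ?_) h1 h2 h4
    rw [← hhi j hj, ← hhi k hk]
    exact hmin k hk (by simp [hm k hk, hkS])

theorem greedyCode_run {J : Jobs} {lo hi : ℕ → ℤ} (hall : Hall J.num lo hi J.ty J.cap)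
    (hlohi : ∀ j < J.num, lo j ≤ hi j) {s : State} (h : HasTables J s)
    (hlo : ∀ j < J.num, s.arr 11 j = lo j) (hhi : ∀ j < J.num, s.arr 12 j = hi j)
    (h9 : ∀ j < J.num, s.arr 9 (j : ℕ) = 0) :
    IsGreedy J.num lo hi J.ty J.cap (Finset.range J.num) (fun i => (greedyCode.run s).arr 10 i)
      (fun i => (greedyCode.run s).arr 3 i) := by
  have key := Code.run_count (x := 6) (b := 4) (p := assignBody) (s := s)
    (fun k s' => ∃ S : Finset ℕ, S.card = k ∧ Marks J.num S s' ∧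
      IsGreedy J.num lo hi J.ty J.cap S (fun i => s'.arr 10 i) (fun i => s'.arr 3 i))
    h.num ⟨∅, rfl, fun i hi => by simpa using h9 i hi, by constructor <;> simp⟩ (by
      rintro k hk s' hx hf ⟨S, hSk, hm, hg⟩
      obtain ⟨j, hjS, hm', hg'⟩ := assignBody_run hall hlohi (h.frame hf (by decide) (by decide))
        (by rw [hf.arr 11 (by decide)]; exact hlo) (by rw [hf.arr 12 (by decide)]; exact hhi)
        hm hg (by omega)
      exact ⟨insert j S, by rw [Finset.card_insert_of_notMem hjS, hSk], hm', hg'⟩)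
  obtain ⟨S, hSn, -, hg⟩ := key
  have : S = Finset.range J.num :=
    Finset.eq_of_subset_of_card_le (fun i hi => Finset.mem_range.mpr (hg.sub i hi)) (by simp [hSn])
  rw [← this]
  exact hg

/-! ### From positions to slots -/

/-- The body of the search for a tall slot. -/
def tallBody : Code :=
  .branch (.conj (.le (.add (.var 9) (.const 1)) (.read 8 (.var 7)))
      (.le (.add (.sub (.read 4 (.var 7)) (.read 8 (.var 7))) (.var 9)) (.var 10)))
    (.assign 10 (.add (.sub (.read 4 (.var 7)) (.read 8 (.var 7))) (.var 9))) .skip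

theorem tallCode_run {J : Jobs} {s : State} (h : HasTables J s) {y : ℕ → ℤ}
    (hy : ∀ i < 2 * J.num, s.arr 8 i = y i)
    (h10 : ∃ i < 2 * J.num, s.var 9 + 1 ≤ y i ∧ s.var 10 = J.tau i - y i + s.var 9) :
    J.IsTallSlot y (s.var 9) (((Code.count 7 5 tallBody).run s).var 10) := by
  refine Code.run_count (x := 7) (b := 5) (p := tallBody) (s := s) (n := 2 * J.num)
    (fun k s' => (∀ i < k, s.var 9 + 1 ≤ y i → s'.var 10 ≤ J.tau i - y i + s.var 9) ∧
      ∃ i < 2 * J.num, s.var 9 + 1 ≤ y i ∧ s'.var 10 = J.tau i - y i + s.var 9)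
    h.twice (by simpa using h10) ?_
  rintro k hk s' hx hf ⟨i1, i2⟩
  have a4 : s'.arr 4 k = J.tau k := by rw [hf.arr 4 (by decide)]; exact h.tau k hk
  have a8 : s'.arr 8 k = y k := by rw [hf.arr 8 (by decide)]; exact hy k hk
  have v9 : s'.var 9 = s.var 9 := hf.var 9 (by decide)
  by_cases hc : s.var 9 + 1 ≤ y k ∧ J.tau k - y k + s.var 9 ≤ s'.var 10
  · have hrun : ((tallBody.run s').setVar 7 (k + 1)).var 10 = J.tau k - y k + s.var 9 := by
      simp only [tallBody, Code.run, Test.Holds, Expr.eval, hx, a4, a8, v9, hc, and_self, if_true]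
      simp
    rw [hrun]
    refine ⟨fun i hi hp => ?_, k, hk, hc.1, rfl⟩
    rcases Nat.lt_succ_iff_lt_or_eq.mp hi with hi | rfl
    · exact hc.2.trans (i1 i hi hp)
    · exact le_rfl
  · have hrun : ((tallBody.run s').setVar 7 (k + 1)).var 10 = s'.var 10 := by
      simp only [tallBody, Code.run, Test.Holds, Expr.eval, hx, a4, a8, v9, hc, if_false]
      simp
    rw [hrun]
    refine ⟨fun i hi hp => ?_, i2⟩
    rcases Nat.lt_succ_iff_lt_or_eq.mp hi with hi | rfl
    · exact i1 i hi hp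
    · by_contra! hlt
      exact hc ⟨hp, hlt.le⟩

/-- The body of the search for a slot that is not tall. -/
def smallBody : Code :=
  .branch (.conj (.le (.sub (.read 4 (.var 7)) (.read 8 (.var 7))) (.var 9))
      (.le (.var 10) (.add (.read 8 (.var 7)) (.var 9))))
    (.assign 10 (.add (.read 8 (.var 7)) (.var 9))) .skip

theorem smallCode_run {J : Jobs} {s : State} (h : HasTables J s) {y : ℕ → ℤ}
    (hy : ∀ i < 2 * J.num, s.arr 8 i = y i)
    (h10 : ∃ i < 2 * J.num, J.tau i - y i ≤ s.var 9 ∧ s.var 10 = y i + s.var 9) :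
    J.IsSmallSlot y (s.var 9) (((Code.count 7 5 smallBody).run s).var 10) := by
  refine Code.run_count (x := 7) (b := 5) (p := smallBody) (s := s) (n := 2 * J.num)
    (fun k s' => (∀ i < k, J.tau i - y i ≤ s.var 9 → y i + s.var 9 ≤ s'.var 10) ∧
      ∃ i < 2 * J.num, J.tau i - y i ≤ s.var 9 ∧ s'.var 10 = y i + s.var 9)
    h.twice (by simpa using h10) ?_
  rintro k hk s' hx hf ⟨i1, i2⟩
  have a4 : s'.arr 4 k = J.tau k := by rw [hf.arr 4 (by decide)]; exact h.tau k hk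
  have a8 : s'.arr 8 k = y k := by rw [hf.arr 8 (by decide)]; exact hy k hk
  have v9 : s'.var 9 = s.var 9 := hf.var 9 (by decide)
  by_cases hc : J.tau k - y k ≤ s.var 9 ∧ s'.var 10 ≤ y k + s.var 9
  · have hrun : ((smallBody.run s').setVar 7 (k + 1)).var 10 = y k + s.var 9 := by
      simp only [smallBody, Code.run, Test.Holds, Expr.eval, hx, a4, a8, v9, hc, and_self, if_true]
      simp
    rw [hrun]
    refine ⟨fun i hi hp => ?_, k, hk, hc.1, rfl⟩
    rcases Nat.lt_succ_iff_lt_or_eq.mp hi with hi | rfl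
    · exact (i1 i hi hp).trans hc.2
    · exact le_rfl
  · have hrun : ((smallBody.run s').setVar 7 (k + 1)).var 10 = s'.var 10 := by
      simp only [smallBody, Code.run, Test.Holds, Expr.eval, hx, a4, a8, v9, hc, if_false]
      simp
    rw [hrun]
    refine ⟨fun i hi hp => ?_, i2⟩
    rcases Nat.lt_succ_iff_lt_or_eq.mp hi with hi | rfl
    · exact i1 i hi hp
    · by_contra! hlt
      exact hc ⟨hp, hlt.le⟩

/-- Computes the slot of the job `var 6`. -/
def slotBody : Code :=
  .assign 9 (.read 10 (.var 6)) ⨾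
  .branch (.eq (.read 5 (.var 6)) (.const 0))
    (.assign 10 (.add (.read 8 (.var 6)) (.var 9)) ⨾ .count 7 5 smallBody)
    (.assign 10 (.add (.sub (.read 4 (.add (.var 4) (.var 6)))
      (.read 8 (.add (.var 4) (.var 6)))) (.var 9)) ⨾ .count 7 5 tallBody) ⨾
  .store 2 (.var 6) (.var 10)

/-- Computes the slots of all jobs. -/
def slotsCode : Code := .count 6 4 slotBody

theorem slotBody_run {J : Jobs} {s : State} (h : HasTables J s) {y : ℕ → ℤ}
    (hy : ∀ i < 2 * J.num, s.arr 8 i = y i) {j : ℕ} (hj : j < J.num) (h6 : s.var 6 = j)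
    (hpos : J.lo y j ≤ s.arr 10 j ∧ s.arr 10 j < J.hi y j) :
    ∃ u, J.IsSlot y j (s.arr 10 j) u ∧
      (slotBody.run s).arr 2 = Function.update (s.arr 2) (j : ℤ) u := by
  have a5 := h.ty j hj
  have a8 := hy j (by omega)
  have a8' : s.arr 8 (J.num + j) = y (J.num + j) := by exact_mod_cast hy (J.num + j) (by omega)
  have a4' : s.arr 4 (J.num + j) = J.deadline j := by
    rw [← J.tau_deadline]; exact_mod_cast h.tau (J.num + j) (by omega)
  have hF : ∀ v w, Frame [9, 10] [] s ((s.setVar 9 v).setVar 10 w) := fun v w =>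
    ⟨fun y hy => by
      simp only [List.mem_cons, List.not_mem_nil, or_false, not_or] at hy
      simp [hy], fun _ _ => rfl⟩
  by_cases hlt : j < J.numSmall
  · have h0 : J.ty j = 0 := by simp [Jobs.ty, hlt]
    simp only [Jobs.lo, Jobs.hi, hlt, if_true] at hpos
    set s₁ := (s.setVar 9 (s.arr 10 j)).setVar 10 (y j + s.arr 10 j) with hs₁
    -- The job's own release time is a valid first candidate for the maximum, since `pos ≥ lo`.
    have hh := smallCode_run (h.frame (hF (s.arr 10 j) (y j + s.arr 10 j)) (by decide) (by decide))
      hy ⟨j, by omega, by rw [J.tau_release hj]; simp; omega, by simp⟩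
    have hf := (Code.count 7 5 smallBody).frame s₁
    refine ⟨((Code.count 7 5 smallBody).run s₁).var 10, ?_, ?_⟩
    · simpa [Jobs.IsSlot, hlt] using hh
    · have e6 : ((Code.count 7 5 smallBody).run s₁).var 6 = j := by
        rw [hf.var 6 (by decide)]; simpa [hs₁] using h6
      have e2 : ((Code.count 7 5 smallBody).run s₁).arr 2 = s.arr 2 := by
        rw [hf.arr 2 (by decide)]; simp [hs₁]
      have hrun : slotBody.run s = ((Code.count 7 5 smallBody).run s₁).setArr 2 j
          (((Code.count 7 5 smallBody).run s₁).var 10) := by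
        rw [← e6]
        simp [slotBody, Code.run_seq, Code.run_branch, Code.run_assign, Code.run_store, Test.Holds,
          Expr.eval, h6, a5, h0, a8, hs₁]
      simp [hrun, e2]
  · have h0 : J.ty j = 1 := by simp [Jobs.ty, hlt]
    simp only [Jobs.lo, Jobs.hi, hlt, if_false] at hpos
    set u₀ := J.deadline j - y (J.num + j) + s.arr 10 j with hu₀
    set s₁ := (s.setVar 9 (s.arr 10 j)).setVar 10 u₀ with hs₁
    -- The job's own deadline is a valid first candidate for the minimum, since `pos < hi`.
    have hh := tallCode_run (h.frame (hF (s.arr 10 j) u₀) (by decide) (by decide))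
      hy ⟨J.num + j, by omega, by simp; omega, by rw [J.tau_deadline]; simp [hu₀]⟩
    have hf := (Code.count 7 5 tallBody).frame s₁
    refine ⟨((Code.count 7 5 tallBody).run s₁).var 10, ?_, ?_⟩
    · simpa [Jobs.IsSlot, hlt] using hh
    · have e6 : ((Code.count 7 5 tallBody).run s₁).var 6 = j := by
        rw [hf.var 6 (by decide)]; simpa [hs₁] using h6
      have e2 : ((Code.count 7 5 tallBody).run s₁).arr 2 = s.arr 2 := by
        rw [hf.arr 2 (by decide)]; simp [hs₁]
      have hrun : slotBody.run s = ((Code.count 7 5 tallBody).run s₁).setArr 2 j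
          (((Code.count 7 5 tallBody).run s₁).var 10) := by
        rw [← e6]
        simp [slotBody, Code.run_seq, Code.run_branch, Code.run_assign, Code.run_store, Test.Holds,
          Expr.eval, h6, a5, h0, a8', a4', h.num, hs₁, hu₀]
      simp [hrun, e2]

theorem slotsCode_run {J : Jobs} {s : State} (h : HasTables J s) {y : ℕ → ℤ}
    (hy : ∀ i < 2 * J.num, s.arr 8 i = y i)
    (hpos : ∀ j < J.num, J.lo y j ≤ s.arr 10 j ∧ s.arr 10 j < J.hi y j) :
    ∀ j < J.num, J.IsSlot y j (s.arr 10 j) ((slotsCode.run s).arr 2 j) := by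
  refine Code.run_count (x := 6) (b := 4) (p := slotBody) (s := s)
    (fun k s' => ∀ j < k, J.IsSlot y j (s.arr 10 j) (s'.arr 2 j)) h.num (by simp) ?_
  intro k hk s' hx hf ih j hj
  have a10 : s'.arr 10 = s.arr 10 := hf.arr 10 (by decide)
  obtain ⟨u, hu, he⟩ := slotBody_run (h.frame hf (by decide) (by decide))
    (by rw [hf.arr 8 (by decide)]; exact hy) hk hx (by rw [a10]; exact hpos k hk)
  rw [a10] at hu
  rw [State.setVar_arr, he]
  rcases Nat.lt_succ_iff_lt_or_eq.mp hj with hj | rfl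
  · rw [Function.update_of_ne (by exact_mod_cast hj.ne)]
    exact ih j hj
  · rw [Function.update_self]
    exact hu

/-- Computes a schedule from the tables. -/
def scheduleCode : Code :=
  weightsCode ⨾ pathsCode ⨾ windowsCode ⨾ greedyCode ⨾ slotsCode

/-- The given feasible schedule serves only to show that the constraints are solvable and the
windows nonempty; the program finds its own solution. -/
theorem scheduleCode_run {J : Jobs} {s : State} (h : HasTables J s)
    (hr : ∀ i < 2 * J.num, s.arr 7 i = (i * (2 * J.num) : ℕ))
    (h9 : ∀ j < J.num, s.arr 9 (j : ℕ) = 0) (hgood : ∃ slot mach, J.Good slot mach) :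
    J.Good (fun j => (scheduleCode.run s).arr 2 j) (fun j => (scheduleCode.run s).arr 3 j) := by
  obtain ⟨slot, mach, hg⟩ := hgood
  have hw : ∀ j < J.num, J.release j < J.deadline j := fun j hj => by
    have := hg.window j hj
    omega
  have f₁ := weightsCode.frame s
  set s₁ := weightsCode.run s with hs₁
  have t₁ : HasTables J s₁ := h.frame f₁ (by decide) (by decide)
  have hwt := weightsCode_run h hr rfl
  rw [← hs₁] at hwt
  have hpot := Jobs.pot_iff hwt
  have hr₁ : ∀ i < 2 * J.num, s₁.arr 7 i = (i * (2 * J.num) : ℕ) := by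
    rw [f₁.arr 7 (by decide)]; exact hr
  have hpaths := pathsCode_run t₁.twice hr₁ ((hpot _).mp hg.pot)
  have f₂ := pathsCode.frame s₁
  set s₂ := pathsCode.run s₁ with hs₂
  have t₂ : HasTables J s₂ := t₁.frame f₂ (by decide) (by decide)
  set y : ℕ → ℤ := fun i => s₂.arr 8 (cell (2 * J.num) 0 i) with hy
  have hP : J.Pot y := (hpot y).mpr hpaths
  have hy₂ : ∀ i < 2 * J.num, s₂.arr 8 i = y i := fun i _ => by simp [hy, cell]
  have hwin := windowsCode_run t₂ hy₂
  have f₃ := windowsCode.frame s₂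
  set s₃ := windowsCode.run s₂ with hs₃
  have t₃ : HasTables J s₃ := t₂.frame f₃ (by decide) (by decide)
  have hgr := greedyCode_run (hP.hall hw) (fun j hj => hP.lo_le_hi hw hj) t₃
    (fun j hj => (hwin j hj).1) (fun j hj => (hwin j hj).2) (fun j hj => by
      rw [f₃.arr 9 (by decide), f₂.arr 9 (by decide), f₁.arr 9 (by decide), h9 j hj])
  have f₄ := greedyCode.frame s₃
  set s₄ := greedyCode.run s₃ with hs₄
  have t₄ : HasTables J s₄ := t₃.frame f₄ (by decide) (by decide)
  have hsl := slotsCode_run t₄ (y := y) (by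
    rw [f₄.arr 8 (by decide), f₃.arr 8 (by decide)]; exact hy₂)
    (fun j hj => hgr.window j (Finset.mem_range.mpr hj))
  have f₅ := slotsCode.frame s₄
  have hrun : scheduleCode.run s = slotsCode.run s₄ := by
    simp only [scheduleCode, hs₄, hs₃, hs₂, hs₁, Code.run_seq]
  rw [hrun, f₅.arr 3 (by decide)]
  refine hP.good (fun j hj => hgr.window j (Finset.mem_range.mpr hj))
    (fun j hj => ?_) (fun i hi j hj => hgr.machine_ne i (Finset.mem_range.mpr hi) j
      (Finset.mem_range.mpr hj)) hsl
  have := hgr.machine j (Finset.mem_range.mpr hj)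
  exact ⟨this.1, this.2.1⟩

/-! ### Checking a schedule -/

/-- Rejects the schedule if the jobs `var 6` and `var 7` are in conflict. -/
def conflictBody : Code :=
  .branch (.conj (.neg (.eq (.var 6) (.var 7)))
      (.conj (.eq (.read 2 (.var 6)) (.read 2 (.var 7)))
        (.neg (.conj (.eq (.read 5 (.var 6)) (.const 0)) (.conj (.eq (.read 5 (.var 7)) (.const 0))
          (.neg (.eq (.read 3 (.var 6)) (.read 3 (.var 7)))))))))
    (.assign 3 (.const 0)) .skip

/-- Rejects the schedule if the job `var 6` is outside its window, has no machine, or is in conflict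
with another job. -/
def checkBody : Code :=
  .branch (.conj (.conj (.le (.read 0 (.var 6)) (.read 2 (.var 6)))
      (.le (.add (.read 2 (.var 6)) (.const 1)) (.read 1 (.var 6))))
      (.conj (.le (.const 0) (.read 3 (.var 6)))
        (.le (.add (.read 3 (.var 6)) (.const 1)) (.read 6 (.var 6)))))
    .skip (.assign 3 (.const 0)) ⨾
  .count 7 4 conflictBody

/-- Checks whether the schedule in the arrays `2` and `3` is feasible. -/
def checkCode : Code := .assign 3 (.const 1) ⨾ .count 6 4 checkBody

/-- The integer `v` is `1` if `P` holds and `0` otherwise. -/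
def IsFlag (P : Prop) (v : ℤ) : Prop := P ∧ v = 1 ∨ ¬ P ∧ v = 0

theorem IsFlag.congr {P Q : Prop} {v : ℤ} (h : IsFlag P v) (hPQ : P ↔ Q) : IsFlag Q v := by
  rwa [← propext hPQ]

theorem IsFlag.and {P Q : Prop} {v w : ℤ} (h : IsFlag P v) (ht : Q → w = v) (hf : ¬ Q → w = 0) :
    IsFlag (P ∧ Q) w := by
  unfold IsFlag at *
  by_cases hQ : Q
  · rw [ht hQ]; simpa [hQ] using h
  · simp [hQ, hf hQ]

theorem conflictCode_run {J : Jobs} {s : State} (h : HasTables J s) {P : Prop}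
    (h3 : IsFlag P (s.var 3)) {i : ℕ} (hi : i < J.num) (h6 : s.var 6 = i) :
    IsFlag (P ∧ ∀ j < J.num, i ≠ j → s.arr 2 i = s.arr 2 j →
      J.ty i = 0 ∧ J.ty j = 0 ∧ s.arr 3 i ≠ s.arr 3 j)
      (((Code.count 7 4 conflictBody).run s).var 3) := by
  refine Code.run_count (x := 7) (b := 4) (p := conflictBody) (s := s)
    (fun k s' => IsFlag (P ∧ ∀ j < k, i ≠ j → s.arr 2 i = s.arr 2 j →
      J.ty i = 0 ∧ J.ty j = 0 ∧ s.arr 3 i ≠ s.arr 3 j) (s'.var 3)) h.num (by simpa using h3) ?_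
  intro k hk s' hx hf ih
  have ht := h.frame hf (by decide) (by decide)
  have v6 : s'.var 6 = i := by rw [hf.var 6 (by decide), h6]
  have a2 : s'.arr 2 = s.arr 2 := hf.arr 2 (by decide)
  have a3 : s'.arr 3 = s.arr 3 := hf.arr 3 (by decide)
  have a5 := ht.ty i hi
  have a5' := ht.ty k hk
  refine (ih.and (Q := i ≠ k → s.arr 2 i = s.arr 2 k →
      J.ty i = 0 ∧ J.ty k = 0 ∧ s.arr 3 i ≠ s.arr 3 k) (fun hQ => ?_) (fun hQ => ?_)).congr ?_
  · have hQ' : ¬ (¬ (i : ℤ) = k ∧ s.arr 2 i = s.arr 2 k ∧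
        ¬ (J.ty i = 0 ∧ J.ty k = 0 ∧ ¬ s.arr 3 i = s.arr 3 k)) := by
      rintro ⟨q1, q2, q3⟩
      exact q3 (hQ (by exact_mod_cast q1) q2)
    simp only [conflictBody, Code.run, Test.Holds, Expr.eval, hx, v6, a2, a3, a5, a5', hQ',
      if_false]
    simp
  · have hQ' : (¬ (i : ℤ) = k ∧ s.arr 2 i = s.arr 2 k ∧
        ¬ (J.ty i = 0 ∧ J.ty k = 0 ∧ ¬ s.arr 3 i = s.arr 3 k)) := by
      push Not at hQ ⊢
      exact ⟨by exact_mod_cast hQ.1, hQ.2.1, fun q1 q2 => hQ.2.2 q1 q2⟩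
    simp only [conflictBody, Code.run, Test.Holds, Expr.eval, hx, v6, a2, a3, a5, a5', hQ']
    simp
  · rw [and_assoc, and_congr_right_iff]
    intro _
    simp only [Nat.forall_lt_succ_right]

theorem checkCode_run {J : Jobs} {s : State} (h : HasTables J s) :
    IsFlag (J.Good (fun j => s.arr 2 j) (fun j => s.arr 3 j)) ((checkCode.run s).var 3) := by
  have key := Code.run_count (x := 6) (b := 4) (p := checkBody) (s := s.setVar 3 1) (n := J.num)
    (fun k s' => IsFlag (∀ i < k, ((J.release i ≤ s.arr 2 i ∧ s.arr 2 i + 1 ≤ J.deadline i) ∧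
      0 ≤ s.arr 3 i ∧ s.arr 3 i + 1 ≤ J.cap i) ∧ ∀ j < J.num, i ≠ j → s.arr 2 i = s.arr 2 j →
      J.ty i = 0 ∧ J.ty j = 0 ∧ s.arr 3 i ≠ s.arr 3 j) (s'.var 3))
    (by simp [h.num]) (by simp [IsFlag]) (by
      intro k hk s' hx hf ih
      have ht : HasTables J s' := (h.frame ⟨fun y hy => by
        simp only [List.mem_singleton] at hy; simp [hy], fun _ _ => rfl⟩
        (W := [3]) (A := []) (by decide) (by decide) : HasTables J (s.setVar 3 1)).frame
          hf (by decide) (by decide)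
      have a2 : s'.arr 2 = s.arr 2 := hf.arr 2 (by decide)
      have a3 : s'.arr 3 = s.arr 3 := hf.arr 3 (by decide)
      have a0 := ht.release k hk
      have a1 := ht.deadline k hk
      have a6 := ht.cap k hk
      set Q := (J.release k ≤ s.arr 2 k ∧ s.arr 2 k + 1 ≤ J.deadline k) ∧
        0 ≤ s.arr 3 k ∧ s.arr 3 k + 1 ≤ J.cap k with hQdef
      obtain ⟨s₁, hs₁, hF, hflag⟩ : ∃ s₁, checkBody.run s' = (Code.count 7 4 conflictBody).run s₁ ∧
          Frame [3] [] s' s₁ ∧ (Q → s₁.var 3 = s'.var 3) ∧ (¬ Q → s₁.var 3 = 0) := by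
        have hB : checkBody.run s' = (Code.count 7 4 conflictBody).run
            (if Q then s' else s'.setVar 3 0) := by
          simp only [checkBody]
          rw [Code.run_seq, Code.run_branch]
          simp only [Code.run_skip, Code.run_assign, Test.Holds, Expr.eval, hx, a0, a1, a2, a3, a6,
            ← hQdef]
        refine ⟨_, hB, ?_, fun hQ => by simp [hQ], fun hQ => by simp [hQ]⟩
        refine ⟨fun y hy => ?_, fun a _ => ?_⟩
        · simp only [List.mem_singleton] at hy
          split_ifs <;> simp [hy]
        · split_ifs <;> simp
      have hc := conflictCode_run (ht.frame hF (by decide) (by decide))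
        (ih.and hflag.1 hflag.2) hk (by rw [hF.var 6 (by decide), hx])
      rw [hF.arr 2 (by decide), hF.arr 3 (by decide), a2, a3, ← hs₁] at hc
      rw [State.setVar_var, Function.update_of_ne (by decide)]
      refine hc.congr ?_
      rw [and_assoc, hQdef]
      simp only [Nat.forall_lt_succ_right])
  refine key.congr ⟨fun hk => ⟨fun i hi => (hk i hi).1.1, fun i hi => (hk i hi).1.2,
    fun i hi => (hk i hi).2⟩, fun hg i hi => ⟨⟨hg.window i hi, hg.machine i hi⟩, hg.conflict i hi⟩⟩

/-! ## The program -/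

/-- The jobs of an instance. -/
def Problem.jobs (I : Problem) : Jobs where
  num := I.numJobs
  numSmall := I.numSmall
  machines := I.machines
  machines_pos := by exact_mod_cast I.machines_pos
  release j := if h : j < I.numJobs then I.release ⟨j, h⟩ else 0
  deadline j := if h : j < I.numJobs then I.deadline ⟨j, h⟩ else 0

/-- Tall jobs receive the dummy machine 0, the only value their capacity 1 allows. -/
theorem Problem.exists_good (I : Problem) {σ : Schedule I} (hσ : σ.Feasible) :
    ∃ slot mach, I.jobs.Good slot mach := by
  refine ⟨fun j => if h : j < I.numJobs then σ.slot ⟨j, h⟩ else 0,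
    fun j => if h : j < I.numSmall then ((σ.machine ⟨j, h⟩ : ℕ) : ℤ) else 0, ?_, ?_, ?_⟩
  · intro j hj
    have hj' : j < I.numJobs := hj
    simpa [Problem.jobs, hj'] using hσ.window ⟨j, hj'⟩
  · intro j hj
    by_cases hs : j < I.numSmall
    · have := (σ.machine ⟨j, hs⟩).isLt
      simp only [Problem.jobs, Jobs.cap, hs, dite_true, if_true]
      omega
    · simp [Problem.jobs, Jobs.cap, hs]
  · intro i hi j hj hij he
    have hi' : i < I.numJobs := hi
    have hj' : j < I.numJobs := hj
    have hn : I.numJobs = I.numSmall + I.numTall := rfl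
    simp only [hi', hj', dite_true] at he
    by_cases hsi : i < I.numSmall <;> by_cases hsj : j < I.numSmall
    · have h1 := hσ.small_small ⟨i, hsi⟩ ⟨j, hsj⟩ (by simpa using hij)
      refine ⟨by simp [Jobs.ty, Problem.jobs, hsi], by simp [Jobs.ty, Problem.jobs, hsj], ?_⟩
      simp only [hsi, hsj, dite_true]
      intro hm
      exact h1 (Prod.ext he (Fin.ext (by exact_mod_cast hm)))
    · obtain ⟨l, rfl⟩ : ∃ l, j = I.numSmall + l := ⟨j - I.numSmall, by omega⟩
      exact absurd he (hσ.small_tall ⟨i, hsi⟩ ⟨l, by omega⟩)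
    · obtain ⟨l, rfl⟩ : ∃ l, i = I.numSmall + l := ⟨i - I.numSmall, by omega⟩
      exact absurd he.symm (hσ.small_tall ⟨j, hsj⟩ ⟨l, by omega⟩)
    · obtain ⟨l, rfl⟩ : ∃ l, i = I.numSmall + l := ⟨i - I.numSmall, by omega⟩
      obtain ⟨k, rfl⟩ : ∃ k, j = I.numSmall + k := ⟨j - I.numSmall, by omega⟩
      exact absurd he (hσ.tall_tall ⟨l, by omega⟩ ⟨k, by omega⟩ (by
        rw [Ne, Fin.mk.injEq]; omega))

theorem Problem.exists_feasible (I : Problem) {s : State}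
    (h : I.jobs.Good (fun j => s.arr 2 j) (fun j => s.arr 3 j)) :
    ∃ σ : Schedule I, σ.Feasible ∧ s.Encodes σ := by
  have hm : ∀ i : Fin I.numSmall, 0 ≤ s.arr 3 (i : ℕ) ∧ s.arr 3 (i : ℕ) < I.machines := fun i => by
    have hi : (i : ℕ) < I.jobs.num := Nat.lt_add_right _ i.isLt
    have := h.machine i hi
    simp only [Problem.jobs, Jobs.cap, i.isLt, if_true] at this
    omega
  refine ⟨⟨fun j => s.arr 2 (j : ℕ), fun i => ⟨(s.arr 3 (i : ℕ)).toNat, by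
    have := hm i
    omega⟩⟩, ⟨fun j => ?_, fun i j hij he => ?_, fun i j he => ?_, fun i j hij he => ?_⟩,
    fun j => rfl, fun i => ?_⟩
  · have := h.window j j.isLt
    simpa [Problem.jobs] using this
  · have := (h.conflict (I.numSmall + i) (Nat.add_lt_add_left i.isLt _) (I.numSmall + j)
      (Nat.add_lt_add_left j.isLt _) (fun h => hij (Fin.ext (by omega))) he).1
    simp [Jobs.ty, Problem.jobs] at this
  · have hi := i.isLt
    have := (h.conflict i (Nat.lt_add_right _ hi) (I.numSmall + j)
      (Nat.add_lt_add_left j.isLt _) (by omega) he).2.1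
    simp [Jobs.ty, Problem.jobs] at this
  · rw [Prod.mk.injEq, Fin.mk.injEq] at he
    have := (h.conflict i (Nat.lt_add_right _ i.isLt) j (Nat.lt_add_right _ j.isLt)
      (fun h => hij (Fin.ext h)) he.1).2.2
    have hi := hm i
    have hj := hm j
    have := he.2
    omega
  · have := hm i
    simp only
    omega

/-- Everything except for the initialization of the loop bounds. -/
def mainCode : Code := tablesCode ⨾ offsetsCode ⨾ scheduleCode ⨾ checkCode

/-- The initial state, with loop bounds. -/
def Problem.start (I : Problem) : State :=
  (I.input.setVar 4 (I.jobs.num : ℕ)).setVar 5 (2 * I.jobs.num : ℕ)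

/-- A program for the tall/small scheduling problem. -/
def solver : Program :=
  .seq (.assign 4 (.add (.var 0) (.var 1)))
    (.seq (.assign 5 (.add (.var 4) (.var 4))) mainCode.toProgram)

theorem Problem.hasInput_start (I : Problem) : HasInput I.jobs I.start where
  numSmall := by simp [Problem.start, Problem.input, Problem.jobs]
  machines := by simp [Problem.start, Problem.input, Problem.jobs]
  num := by simp [Problem.start]
  twice := by simp [Problem.start]
  release j hj := by
    have hj' : j < I.numJobs := hj
    simp [Problem.start, Problem.input, Problem.jobs, hj']
  deadline j hj := by
    have hj' : j < I.numJobs := hj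
    simp [Problem.start, Problem.input, Problem.jobs, hj']

/-- A positive check certifies the schedule in memory. A negative one excludes every feasible
schedule, because otherwise `scheduleCode_run` would have produced one that passes. -/
theorem Problem.isCorrectAnswer_mainCode (I : Problem) :
    I.IsCorrectAnswer (mainCode.run I.start) := by
  have h := I.hasInput_start
  have t₁ := tablesCode_run h
  have f₁ := tablesCode.frame I.start
  set s₁ := tablesCode.run I.start with hs₁
  have hoff := offsetsCode_run t₁.twice
  have f₂ := offsetsCode.frame s₁
  set s₂ := offsetsCode.run s₁ with hs₂
  have t₂ := t₁.frame f₂ (by decide) (by decide)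
  have hsched := scheduleCode_run t₂ hoff (fun j _ => by
    rw [f₂.arr 9 (by decide), f₁.arr 9 (by decide)]
    simp [Problem.start, Problem.input])
  have f₃ := scheduleCode.frame s₂
  set s₃ := scheduleCode.run s₂ with hs₃
  have t₃ := t₂.frame f₃ (by decide) (by decide)
  have hcheck := checkCode_run t₃
  have f₄ := checkCode.frame s₃
  have hrun : mainCode.run I.start = checkCode.run s₃ := by
    simp only [mainCode, hs₃, hs₂, hs₁, Code.run_seq]
  rw [hrun]
  rw [← f₄.arr 2 (by decide), ← f₄.arr 3 (by decide)] at hcheck hsched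
  rcases hcheck with ⟨hg, hv⟩ | ⟨hg, hv⟩
  · exact .inl ⟨hv, I.exists_feasible hg⟩
  · exact .inr ⟨hv, fun ⟨σ, hσ⟩ => hg (hsched (I.exists_good hσ))⟩

theorem solver_exec (I : Problem) :
    ∃ t ≤ mainCode.time (2 * I.numJobs) + 8, Exec solver I.input (mainCode.run I.start) t := by
  -- Variables `4` and `5` are the only loop bounds, and both are at most twice the number of jobs.
  -- The two initial assignments cost 4 each.
  obtain ⟨t, ht, hE⟩ := Code.exec (B := [4, 5]) (N := 2 * I.numJobs) (p := mainCode) (by decide)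
    (s := I.start) (by simp [Problem.start, Problem.jobs]; omega)
  refine ⟨_, ?_, .seq (.assign _ _ _) (.seq (.assign _ _ _) (?_ : Exec _ _ _ t))⟩
  · simp only [Expr.cost]
    omega
  · convert hE using 1
    simp [Expr.eval, Problem.start, Problem.input, Problem.jobs, two_mul]

end TallSmall

theorem mainTheorem4 :
    ∃ (p : TallSmall.Program) (C : ℕ),
      p.SolvesWithin (fun I => C * (I.numJobs ^ 3 + 1)) := by
  obtain ⟨K, hK⟩ := TallSmall.mainCode.exists_time_le
  refine ⟨TallSmall.solver, 27 * K + 8, fun I => ?_⟩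
  obtain ⟨t, ht, hE⟩ := TallSmall.solver_exec I
  refine ⟨_, t, hE, ?_, I.isCorrectAnswer_mainCode⟩
  have hd : TallSmall.mainCode.depth = 3 := by decide
  have h1 := hK (2 * I.numJobs)
  rw [hd] at h1
  -- For n ≥ 1, 2n + 1 ≤ 3n, whence the factor 27.
  have h2 : (2 * I.numJobs + 1) ^ 3 ≤ 27 * (I.numJobs ^ 3 + 1) := by
    rcases Nat.eq_zero_or_pos I.numJobs with h0 | h0
    · simp [h0]
    · calc (2 * I.numJobs + 1) ^ 3 ≤ (3 * I.numJobs) ^ 3 := Nat.pow_le_pow_left (by omega) 3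
        _ ≤ 27 * (I.numJobs ^ 3 + 1) := by rw [mul_pow]; omega
  calc t ≤ K * (27 * (I.numJobs ^ 3 + 1)) + 8 := by
        have := Nat.mul_le_mul_left K h2
        omega
    _ ≤ (27 * K + 8) * (I.numJobs ^ 3 + 1) := by nlinarith [Nat.zero_le (I.numJobs ^ 3)]
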